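/- Let $\omega > 0$ and $0 < c < v$. Let $\Sigma = \{2, 0, -2\}$ and $E = \mathbb{R}_+ \times \Sigma$ with $\mathbb{R}_+ = [0, \infty)$. The instantaneous linear process $X(t) = (x(t), \sigma(t))$, $t \ge 0$, is the $E$-valued process in which $\sigma(t)$ is the Markov jump process on $\Sigma$ with transition rates $2 \to 0$ and $-2 \to 0$ at rate $2\omega$, and $0 \to 2$ and $0 \to -2$ at rate $\omega$ each (all other rates being zero), and, with $0 = T_0 < T_1 < \cdots$ the jump times of $\sigma$, $$ x(t) = \max\bigl[0,\ x(T_n) + (t - T_n)\,(v\,\sigma(T_n) - 2c)\bigr], \qquad t \in [T_n, T_{n+1}], $$ where $\sigma(T_n)$ is the velocity just after the jump at time $T_n$. A probability measure $\pi$ on $E$ is called invariant if $\pi P_t = \pi$ for all $t \ge 0$, where $P_t((x,\sigma), \cdot)$ is the law of $X(t)$ when $X(0) = (x, \sigma)$. **Proposition.** The instantaneous linear process has a unique invariant probability measure, and it is $$ \pi = \sum_{\sigma \in \Sigma} \left( d_\sigma \delta_0 + a_\sigma e^{\zeta x}\, dx \right) \otimes \delta_\sigma , $$ where $\delta_0$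 is the Dirac mass at $0$ and $dx$ is Lebesgue measure on $\mathbb{R}_+$, $\zeta = -\frac{2c\omega}{v^2 - c^2}$, and $$ d_2 = 0, \qquad d_0 = \frac{c}{c+v}, \qquad d_{-2} = \frac{cv}{(c+v)^2}, $$ $$ a_2 = \frac{c\omega}{2(v^2 - c^2)}, \qquad a_0 = \frac{c\omega}{(c+v)^2}, \qquad a_{-2} = \frac{c(v-c)\omega}{2(c+v)^3}. $$ In particular $d_2 = 0$ while $d_0, d_{-2} > 0$. -/

import Mathlib

open MeasureTheory ProbabilityTheory
open scoped NNReal ENNReal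

noncomputable section

namespace RunTumble

/-- The state space `Σ = {2, 0, -2}` of the relative velocity. -/
inductive RelVel
  | pos2
  | zero
  | neg2
  deriving DecidableEq

instance : Fintype RelVel := ⟨{.pos2, .zero, .neg2}, fun σ => by cases σ <;> decide⟩

instance : MeasurableSpace RelVel := ⊤

instance : DiscreteMeasurableSpace RelVel := ⟨fun _ => trivial⟩

/-- The numerical value of a relative velocity. -/
def RelVel.val : RelVel → ℝ
  | .pos2 => 2
  | .zero => 0
  | .neg2 => -2

/-- The state space `E = ℝ₊ × Σ` of the process `X(t) = (x(t), σ(t))`. -/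
abbrev State : Type := ℝ≥0 × RelVel

/-! ### The Markov jump process of the relative velocity -/

/-- The transition-rate matrix of the relative velocity (instantaneous tumbles). -/
def rateMatrix (ω : ℝ) : Matrix RelVel RelVel ℝ
  | .pos2, .pos2 => -2 * ω
  | .pos2, .zero => 2 * ω
  | .pos2, .neg2 => 0
  | .zero, .pos2 => ω
  | .zero, .zero => -2 * ω
  | .zero, .neg2 => ω
  | .neg2, .pos2 => 0
  | .neg2, .zero => 2 * ω
  | .neg2, .neg2 => -2 * ω

/-- The total rate `-q_{σ,σ}` at which the jump process leaves `σ`. -/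
def exitRate (ω : ℝ) (σ : RelVel) : ℝ := -rateMatrix ω σ σ

/-- The law of the next state of the jump process when it leaves `σ`: the state `τ ≠ σ` is
chosen with probability `q_{σ,τ} / (-q_{σ,σ})`. -/
def jumpLaw (ω : ℝ) (σ : RelVel) : Measure RelVel :=
  ∑ τ : RelVel, (if τ = σ then 0 else ENNReal.ofReal (rateMatrix ω σ τ / exitRate ω σ)) •
    Measure.dirac τ

/-- The law of a pair (state, holding time in this state) when the state is `σ`: the holding
time is exponential with parameter `-q_{σ,σ}`. -/
def holdLaw (ω : ℝ) (σ : RelVel) : Measure (RelVel × ℝ) :=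
  (Measure.dirac σ).prod (expMeasure (exitRate ω σ))

/-- One step of the Markov chain (state, holding time): jump from the current state, then draw
the holding time in the new state. -/
def stepKernel (ω : ℝ) : Kernel RelVel (RelVel × ℝ) :=
  Kernel.ofFunOfCountable (holdLaw ω) ∘ₖ Kernel.ofFunOfCountable (jumpLaw ω)

lemma exitRate_eq (ω : ℝ) (σ : RelVel) : exitRate ω σ = 2 * ω := by
  cases σ <;> simp [exitRate, rateMatrix]

lemma isProbabilityMeasure_jumpLaw {ω : ℝ} (hω : 0 < ω) (σ : RelVel) :
    IsProbabilityMeasure (jumpLaw ω σ) := by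
  have huniv : (Finset.univ : Finset RelVel) = {.pos2, .zero, .neg2} := rfl
  have h1 : 2 * ω / (2 * ω) = 1 := div_self (by positivity)
  have h2 : ω / (2 * ω) = 1 / 2 := by field_simp
  refine ⟨?_⟩
  cases σ
  · simp [jumpLaw, huniv, exitRate_eq, rateMatrix, h1]
  · simp [jumpLaw, huniv, exitRate_eq, rateMatrix, h2, ENNReal.inv_two_add_inv_two]
  · simp [jumpLaw, huniv, exitRate_eq, rateMatrix, h1]

lemma isProbabilityMeasure_holdLaw {ω : ℝ} (hω : 0 < ω) (σ : RelVel) :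
    IsProbabilityMeasure (holdLaw ω σ) := by
  have := isProbabilityMeasure_expMeasure (r := exitRate ω σ) (by rw [exitRate_eq]; positivity)
  unfold holdLaw
  infer_instance

lemma isMarkovKernel_stepKernel {ω : ℝ} (hω : 0 < ω) : IsMarkovKernel (stepKernel ω) := by
  have h1 : IsMarkovKernel (Kernel.ofFunOfCountable (jumpLaw ω)) :=
    ⟨fun σ => isProbabilityMeasure_jumpLaw hω σ⟩
  have h2 : IsMarkovKernel (Kernel.ofFunOfCountable (holdLaw ω)) :=
    ⟨fun σ => isProbabilityMeasure_holdLaw hω σ⟩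
  unfold stepKernel
  infer_instance

/-- The step from `(σ_0, τ_0), …, (σ_n, τ_n)` to `(σ_{n+1}, τ_{n+1})`; it only depends on `σ_n`. -/
def historyKernel (ω : ℝ) (n : ℕ) : Kernel (Π _ : Finset.Iic n, RelVel × ℝ) (RelVel × ℝ) :=
  (stepKernel ω).comap (fun h => (h ⟨n, Finset.mem_Iic.2 le_rfl⟩).1) (by fun_prop)

lemma isMarkovKernel_historyKernel {ω : ℝ} (hω : 0 < ω) (n : ℕ) :
    IsMarkovKernel (historyKernel ω n) := by
  have := isMarkovKernel_stepKernel hω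
  unfold historyKernel
  infer_instance

/-- The law of the sequence `(σ_n, τ_n)_{n ≥ 0}` of successive states and holding times of the
Markov jump process with rate matrix `rateMatrix ω` started at `σ`. -/
def velocityLaw (ω : ℝ) (hω : 0 < ω) (σ : RelVel) : Measure (ℕ → RelVel × ℝ) :=
  have := isProbabilityMeasure_holdLaw hω σ
  have := isMarkovKernel_historyKernel hω
  Kernel.trajMeasure (X := fun _ => RelVel × ℝ) (holdLaw ω σ) (historyKernel ω)

/-! ### The relative position -/

/-- The flow `φ^σ_t(x)` of the ODE `∂ₜ x = -2 V'(x) + v σ` for `V(x) = c |x|`; as `V' = c` on the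
half-line, the equation is `∂ₜ x = -2 c + v σ`. -/
def flow (c v : ℝ) (σ : RelVel) (t x : ℝ) : ℝ := x + t * (-2 * c + v * σ.val)

/-- The jump time `T_n`, where `m n = (σ_n, τ_n)` and `T_0 = 0`. -/
def jumpTime (m : ℕ → RelVel × ℝ) (n : ℕ) : ℝ := ∑ i ∈ Finset.range n, (m i).2

/-- The position `x(T_n)` at the jump times, started at `x(0) = x₀`. -/
def positionAtJump (c v : ℝ) (x₀ : ℝ≥0) (m : ℕ → RelVel × ℝ) : ℕ → ℝ≥0
  | 0 => x₀
  | n + 1 => Real.toNNReal (flow c v (m n).1 (jumpTime m (n + 1) - jumpTime m n)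
      (positionAtJump c v x₀ m n))

/-- The index `n` with `T_n ≤ t < T_{n+1}`. It exists for all `t ≥ 0` almost surely. -/
def jumpIndex (m : ℕ → RelVel × ℝ) (t : ℝ) : ℕ := sInf {n | t < jumpTime m (n + 1)}

/-- The state `X(t) = (x(t), σ(t))` with `x(t) = max(0, φ^{σ_n}_{t - T_n}(x(T_n)))` and
`σ(t) = σ_n` for `t ∈ [T_n, T_{n+1})`. -/
def process (c v : ℝ) (t : ℝ) (x₀ : ℝ≥0) (m : ℕ → RelVel × ℝ) : State :=
  let n := jumpIndex m t
  (Real.toNNReal (flow c v (m n).1 (t - jumpTime m n) (positionAtJump c v x₀ m n)), (m n).1)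

lemma measurable_jumpTime (n : ℕ) : Measurable fun m : ℕ → RelVel × ℝ => jumpTime m n := by
  unfold jumpTime
  fun_prop

lemma measurable_jumpIndex (t : ℝ) : Measurable fun m => jumpIndex m t := by
  refine measurable_of_Iic fun n => ?_
  have h : (fun m => jumpIndex m t) ⁻¹' Set.Iic n =
      (⋃ k ∈ Set.Iic n, {m | t < jumpTime m (k + 1)}) ∪ ⋂ k, {m | t < jumpTime m (k + 1)}ᶜ := by
    ext m
    simp only [Set.mem_preimage, Set.mem_Iic, Set.mem_union, Set.mem_iUnion, Set.mem_iInter,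
      Set.mem_ofPred_eq, Set.mem_compl_iff, jumpIndex, exists_prop]
    constructor
    · intro hn
      by_cases hne : ∃ k, t < jumpTime m (k + 1)
      · exact Or.inl ⟨_, hn, Nat.sInf_mem (s := {n | t < jumpTime m (n + 1)}) hne⟩
      · exact Or.inr fun k hk => hne ⟨k, hk⟩
    · rintro (⟨k, hk, hkt⟩ | hall)
      · exact (Nat.sInf_le (s := {n | t < jumpTime m (n + 1)}) hkt).trans hk
      · have : {n | t < jumpTime m (n + 1)} = ∅ := Set.eq_empty_of_forall_notMem hall
        simp [this]
  rw [h]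
  have hm : ∀ k, MeasurableSet {m : ℕ → RelVel × ℝ | t < jumpTime m (k + 1)} := fun k =>
    measurableSet_lt measurable_const (measurable_jumpTime _)
  exact (MeasurableSet.biUnion (Set.to_countable _) fun k _ => hm k).union
    (MeasurableSet.iInter fun k => (hm k).compl)

lemma measurable_flow (c v : ℝ) :
    Measurable fun p : RelVel × ℝ × ℝ => flow c v p.1 p.2.1 p.2.2 := by
  have : Measurable RelVel.val := measurable_of_countable _
  unfold flow
  fun_prop

lemma measurable_positionAtJump (c v : ℝ) (n : ℕ) :
    Measurable fun p : ℝ≥0 × (ℕ → RelVel × ℝ) => positionAtJump c v p.1 p.2 n := by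
  induction n with
  | zero => exact measurable_fst
  | succ n ih =>
    have h1 := measurable_jumpTime n
    have h2 := measurable_jumpTime (n + 1)
    exact ((measurable_flow c v).comp (f := fun p : ℝ≥0 × (ℕ → RelVel × ℝ) =>
      ((p.2 n).1, jumpTime p.2 (n + 1) - jumpTime p.2 n, (positionAtJump c v p.1 p.2 n : ℝ)))
      (by fun_prop)).real_toNNReal

lemma measurable_process (c v t : ℝ) :
    Measurable fun p : ℝ≥0 × (ℕ → RelVel × ℝ) => process c v t p.1 p.2 := by
  have key : Measurable fun q : (ℝ≥0 × (ℕ → RelVel × ℝ)) × ℕ =>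
      ((Real.toNNReal (flow c v (q.1.2 q.2).1 (t - jumpTime q.1.2 q.2)
        (positionAtJump c v q.1.1 q.1.2 q.2)), (q.1.2 q.2).1) : State) := by
    refine measurable_from_prod_countable_left fun n => ?_
    have h1 := measurable_jumpTime n
    have h2 := measurable_positionAtJump c v n
    exact (((measurable_flow c v).comp (f := fun p : ℝ≥0 × (ℕ → RelVel × ℝ) =>
      ((p.2 n).1, t - jumpTime p.2 n, (positionAtJump c v p.1 p.2 n : ℝ)))
      (by fun_prop)).real_toNNReal).prodMk
      (measurable_fst.comp ((measurable_pi_apply n).comp measurable_snd))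
  have h := measurable_jumpIndex t
  exact key.comp (g := _) (f := fun p : ℝ≥0 × (ℕ → RelVel × ℝ) => (p, jumpIndex p.2 t))
    (by fun_prop)

lemma isProbabilityMeasure_velocityLaw {ω : ℝ} (hω : 0 < ω) (σ : RelVel) :
    IsProbabilityMeasure (velocityLaw ω hω σ) := by
  have := isProbabilityMeasure_holdLaw hω σ
  have := isMarkovKernel_historyKernel hω
  unfold velocityLaw
  infer_instance

/-- The transition semigroup `P_t` of the instantaneous linear process: `P_t((x, σ), ·)` is the
law of `X(t)` when `X(0) = (x, σ)`. -/
def transition (ω c v : ℝ) (hω : 0 < ω) (t : ℝ) : Kernel State State where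
  toFun z := (velocityLaw ω hω z.2).map (process c v t z.1)
  measurable' := by
    refine measurable_from_prod_countable_left fun σ => ?_
    have := isProbabilityMeasure_velocityLaw hω σ
    have hm := measurable_process c v t
    refine Measure.measurable_of_measurable_coe _ fun s hs => ?_
    refine Eq.subst (motive := Measurable) ?_
      (measurable_measure_prodMk_left (ν := velocityLaw ω hω σ) (hm hs))
    ext x
    exact (Measure.map_apply (hm.comp measurable_prodMk_left) hs).symm

/-- `μ` is an invariant probability measure of the instantaneous linear process. -/
def IsInvariantProbability (ω c v : ℝ) (hω : 0 < ω) (μ : Measure State) : Prop :=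
  IsProbabilityMeasure μ ∧ ∀ t : ℝ, 0 ≤ t → (transition ω c v hω t).Invariant μ

/-! ### The explicit measure -/

/-- The exponent `ζ`. -/
def zeta (ω c v : ℝ) : ℝ := -(2 * c * ω) / (v ^ 2 - c ^ 2)

/-- The weights `d_σ` of the Dirac masses at `0`. -/
def diracWeight (c v : ℝ) : RelVel → ℝ
  | .pos2 => 0
  | .zero => c / (c + v)
  | .neg2 => c * v / (c + v) ^ 2

/-- The prefactors `a_σ` of the densities. -/
def densityWeight (ω c v : ℝ) : RelVel → ℝ
  | .pos2 => c * ω / (2 * (v ^ 2 - c ^ 2))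
  | .zero => c * ω / (c + v) ^ 2
  | .neg2 => c * (v - c) * ω / (2 * (c + v) ^ 3)

/-- Lebesgue measure `dx` on `ℝ₊`. -/
def lebesgueHalfLine : Measure ℝ≥0 := (volume.restrict (Set.Ici (0 : ℝ))).map Real.toNNReal

/-- The measure `∑_σ (d_σ δ_0 + a_σ e^{ζ x} dx) ⊗ δ_σ` on `ℝ₊ × Σ`. -/
def explicitMeasure (ω c v : ℝ) : Measure State :=
  ∑ σ : RelVel,
    (ENNReal.ofReal (diracWeight c v σ) • Measure.dirac (0 : ℝ≥0) +
      lebesgueHalfLine.withDensity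
        fun x => ENNReal.ofReal (densityWeight ω c v σ * Real.exp (zeta ω c v * x))).prod
      (Measure.dirac σ)

end RunTumble

end

noncomputable section

namespace RunTumble

/-! Existence. Every velocity is left at the same rate 2ω, so conditioning on the first jump gives a
renewal equation for `P_t f` whose kernel on [0, t] has mass 1 - e^{-2ωt} < 1. Iterating an estimate
with such a factor (`le_of_contraction`) shows that a bounded solution lies below every solution
(`le_of_renewal`), hence bounded solutions coincide. This replaces the first-jump equation by the
last-jump equation (`lintegral_transition_eq_last_jump`), in which the semigroup stands outermost
and can be integrated against a measure π on the initial state.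

Write Φ_s for the clamped flow and J for the jump operator. The last-jump equation expresses π P_t f
through π P_s (J(f ∘ Φ_{t-s})) with s ≤ t. The constant π f satisfies the same equation as soon as π
f = e^{-2ωt} π(f ∘ Φ_t) + ∫_0^t 2ω e^{-2ωs} π(J(f ∘ Φ_s)) ds. This balance is the stationarity
equation in integrated form, so no generator or domain is needed. A contraction over all times up to
t and all [0, 1]-valued test functions then gives π P_t f = π f.

The balance is checked on tails. Each marginal of the explicit measure has a mass M and a tail B
e^{ζy} for y > 0. Clamping at 0 is invisible on {x ≥ a} when a > 0, so the balance reduces to one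
real integral with an explicit primitive, provided (2ω + ζk) B = 2ω B', where k is the speed of the
flow and B' is the tail weight of the incoming positions (`integral_expTail`). An upward flow
carries the atom away from 0, so the primitive is continuous only if B = M; this is why velocity 2
has no atom.

Uniqueness. A nonzero invariant measure charges the state (0, -2), because every state reaches it
with positive probability. For invariant probabilities μ and ν the measures μ - μ ⊓ ν and ν - μ ⊓ ν
are invariant too. If both were nonzero, both would charge that state, contradicting the maximality
of μ ⊓ ν. So one of them vanishes, and μ and ν, having equal mass, are equal. -/

/-! ### Markov property of the sequence of states and holding times -/

/-- The sequence `p, m 0, m 1, …`. -/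
def consSeq {X : Type*} (p : X) (m : ℕ → X) : ℕ → X
  | 0 => p
  | n + 1 => m n

lemma measurable_consSeq {X : Type*} [MeasurableSpace X] :
    Measurable fun q : X × (ℕ → X) => consSeq q.1 q.2 := by
  refine measurable_pi_lambda _ fun n => ?_
  cases n with
  | zero => exact measurable_fst
  | succ n => exact (measurable_pi_apply n).comp measurable_snd

/-- A law on sequences is determined by its initial law and its one-step kernels. -/
lemma eq_of_initial_of_step {X : Type*} [MeasurableSpace X] {A B : Measure (ℕ → X)}
    [IsFiniteMeasure A] (κ : ∀ n, Kernel (Π _ : Finset.Iic n, X) X) [IsFiniteMeasure B]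
    (h0 : A.map (fun m => m 0) = B.map (fun m => m 0))
    (hA : ∀ n, A.map (fun m => (Preorder.frestrictLe (π := fun _ => X) n m, m (n + 1))) =
      A.map (Preorder.frestrictLe n) ⊗ₘ κ n)
    (hB : ∀ n, B.map (fun m => (Preorder.frestrictLe (π := fun _ => X) n m, m (n + 1))) =
      B.map (Preorder.frestrictLe n) ⊗ₘ κ n) : A = B := by
  have key : ∀ n, A.map (Preorder.frestrictLe n) = B.map (Preorder.frestrictLe n) := by
    intro n
    induction n with
    | zero =>
      have h : (Preorder.frestrictLe 0 : (ℕ → X) → _) =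
          (fun (y : X) (_ : Finset.Iic 0) => y) ∘ fun m => m 0 := by
        ext m ⟨i, hi⟩
        obtain rfl : i = 0 := by simpa using hi
        rfl
      rw [h, ← Measure.map_map (by fun_prop) (by fun_prop), h0,
        Measure.map_map (by fun_prop) (by fun_prop)]
    | succ n ih =>
      let Φ : (Π _ : Finset.Iic n, X) × X → (Π _ : Finset.Iic (n + 1), X) := fun q i =>
        if h : i.1 ≤ n then q.1 ⟨i.1, Finset.mem_Iic.2 h⟩ else q.2
      have hΦ : Measurable Φ := by
        refine measurable_pi_lambda _ fun i => ?_
        by_cases h : i.1 ≤ n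
        · simp only [Φ, h, dite_true]; fun_prop
        · simp only [Φ, h, dite_false]; fun_prop
      have h : (Preorder.frestrictLe (n + 1) : (ℕ → X) → _) =
          Φ ∘ fun m => (Preorder.frestrictLe (π := fun _ => X) n m, m (n + 1)) := by
        ext m ⟨i, hi⟩
        by_cases h : i ≤ n
        · simp [Φ, h]
        · obtain rfl : i = n + 1 := by have := Finset.mem_Iic.1 hi; omega
          simp [Φ]
      rw [h, ← Measure.map_map hΦ (by fun_prop), ← Measure.map_map hΦ (by fun_prop), hA, hB, ih]
  -- A measure is the projective limit of its own marginals, and every finite index set lies in an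
  -- initial segment, so equality on initial segments is enough.
  have hproj : ∀ (C : Measure (ℕ → X)) [IsFiniteMeasure C],
      IsProjectiveLimit C (fun I : Finset ℕ => C.map I.restrict) := fun C _ I => rfl
  refine (hproj A).unique (ν := B) fun I => ?_
  have h : (I.restrict : (ℕ → X) → _) =
      Finset.restrict₂ (π := fun _ => X) (Finset.subset_Iic_sup_id I) ∘
        Preorder.frestrictLe (I.sup id) := rfl
  have hr := Finset.measurable_restrict₂ (X := fun _ : ℕ => X) (Finset.subset_Iic_sup_id I)
  change B.map I.restrict = A.map I.restrict
  rw [h, ← Measure.map_map hr (by fun_prop), ← Measure.map_map hr (by fun_prop), key]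

variable {ω : ℝ}

lemma map_step_velocityLaw (hω : 0 < ω) (σ : RelVel) (n : ℕ) :
    (velocityLaw ω hω σ).map
        (fun m => (Preorder.frestrictLe (π := fun _ => RelVel × ℝ) n m, m (n + 1))) =
      (velocityLaw ω hω σ).map (Preorder.frestrictLe n) ⊗ₘ historyKernel ω n := by
  have := isProbabilityMeasure_holdLaw hω σ
  have := isMarkovKernel_historyKernel hω
  exact (Kernel.map_frestrictLe_trajMeasure_compProd_eq_map_trajMeasure
    (X := fun _ => RelVel × ℝ)).symm

lemma map_zero_velocityLaw (hω : 0 < ω) (σ : RelVel) :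
    (velocityLaw ω hω σ).map (fun m => m 0) = holdLaw ω σ := by
  have := isProbabilityMeasure_holdLaw hω σ
  have := isMarkovKernel_historyKernel hω
  have h : (fun m : ℕ → RelVel × ℝ => m 0) =
      (fun x : Π _ : Finset.Iic 0, RelVel × ℝ => x ⟨0, by simp⟩) ∘ Preorder.frestrictLe 0 := rfl
  rw [h, ← Measure.map_map (by fun_prop) (by fun_prop), velocityLaw, Kernel.trajMeasure,
    Measure.map_comp _ _ (by fun_prop), Kernel.traj_map_frestrictLe, Kernel.partialTraj_self,
    Measure.id_comp, Measure.map_map (by fun_prop) (by fun_prop)]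
  exact Measure.map_id

lemma lintegral_step_velocityLaw (hω : 0 < ω) (σ : RelVel) (n : ℕ)
    {G : (Π _ : Finset.Iic n, RelVel × ℝ) × (RelVel × ℝ) → ℝ≥0∞} (hG : Measurable G) :
    ∫⁻ m, G (Preorder.frestrictLe n m, m (n + 1)) ∂velocityLaw ω hω σ =
      ∫⁻ m, ∫⁻ y, G (Preorder.frestrictLe n m, y) ∂stepKernel ω (m n).1 ∂velocityLaw ω hω σ := by
  have := isMarkovKernel_historyKernel hω
  have := isProbabilityMeasure_velocityLaw hω σ
  have h := congrArg (fun μ => ∫⁻ q, G q ∂μ) (map_step_velocityLaw hω σ n)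
  beta_reduce at h
  rw [lintegral_map hG (by fun_prop), Measure.lintegral_compProd hG,
    lintegral_map (by fun_prop) (by fun_prop)] at h
  exact h

lemma lintegral_zero_velocityLaw (hω : 0 < ω) (σ : RelVel) {G : RelVel × ℝ → ℝ≥0∞}
    (hG : Measurable G) : ∫⁻ m, G (m 0) ∂velocityLaw ω hω σ = ∫⁻ p, G p ∂holdLaw ω σ := by
  rw [← map_zero_velocityLaw hω, lintegral_map hG (by fun_prop)]

/-- The law of the sequence of states and holding times after the first one. -/
def tailKernel (ω : ℝ) (hω : 0 < ω) : Kernel (RelVel × ℝ) (ℕ → RelVel × ℝ) :=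
  (Kernel.ofFunOfCountable (velocityLaw ω hω) ∘ₖ Kernel.ofFunOfCountable (jumpLaw ω)).comap
    Prod.fst measurable_fst

lemma lintegral_tailKernel (hω : 0 < ω) (p : RelVel × ℝ) {F : (ℕ → RelVel × ℝ) → ℝ≥0∞}
    (hF : Measurable F) :
    ∫⁻ m, F m ∂tailKernel ω hω p = ∫⁻ τ, ∫⁻ m, F m ∂velocityLaw ω hω τ ∂jumpLaw ω p.1 := by
  rw [tailKernel, Kernel.comap_apply, Kernel.lintegral_comp _ _ _ hF]
  rfl

lemma lintegral_stepKernel (σ : RelVel) {F : RelVel × ℝ → ℝ≥0∞} (hF : Measurable F) :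
    ∫⁻ p, F p ∂stepKernel ω σ = ∫⁻ τ, ∫⁻ p, F p ∂holdLaw ω τ ∂jumpLaw ω σ := by
  rw [stepKernel, Kernel.lintegral_comp _ _ _ hF]
  rfl

lemma isMarkovKernel_tailKernel (hω : 0 < ω) : IsMarkovKernel (tailKernel ω hω) := by
  have h1 : IsMarkovKernel (Kernel.ofFunOfCountable (jumpLaw ω)) :=
    ⟨fun σ => isProbabilityMeasure_jumpLaw hω σ⟩
  have h2 : IsMarkovKernel (Kernel.ofFunOfCountable (velocityLaw ω hω)) :=
    ⟨fun σ => isProbabilityMeasure_velocityLaw hω σ⟩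
  unfold tailKernel
  infer_instance

/-- The first state and holding time, followed by a velocity process started after a jump. -/
def restartLaw (ω : ℝ) (hω : 0 < ω) (σ : RelVel) : Measure (ℕ → RelVel × ℝ) :=
  (holdLaw ω σ ⊗ₘ tailKernel ω hω).map fun q => consSeq q.1 q.2

lemma lintegral_restartLaw (hω : 0 < ω) (σ : RelVel) {F : (ℕ → RelVel × ℝ) → ℝ≥0∞}
    (hF : Measurable F) :
    ∫⁻ m, F m ∂restartLaw ω hω σ =
      ∫⁻ p, ∫⁻ τ, ∫⁻ m, F (consSeq p m) ∂velocityLaw ω hω τ ∂jumpLaw ω p.1 ∂holdLaw ω σ := by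
  have := isProbabilityMeasure_holdLaw hω σ
  have := isMarkovKernel_tailKernel hω
  have hc := measurable_consSeq (X := RelVel × ℝ)
  rw [restartLaw, lintegral_map hF hc, Measure.lintegral_compProd (f := fun q => F (consSeq q.1 q.2)) (hF.comp hc)]
  refine lintegral_congr fun p => ?_
  exact lintegral_tailKernel hω p (F := fun m => F (consSeq p m))
    (hF.comp (hc.comp measurable_prodMk_left))

lemma isProbabilityMeasure_restartLaw (hω : 0 < ω) (σ : RelVel) :
    IsProbabilityMeasure (restartLaw ω hω σ) := by
  have := isProbabilityMeasure_holdLaw hω σ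
  have := isMarkovKernel_tailKernel hω
  exact Measure.isProbabilityMeasure_map measurable_consSeq.aemeasurable

/-- The Markov property of the velocity process at its first jump time. -/
lemma velocityLaw_eq_restartLaw (hω : 0 < ω) (σ : RelVel) :
    velocityLaw ω hω σ = restartLaw ω hω σ := by
  have := isProbabilityMeasure_velocityLaw hω
  have := isProbabilityMeasure_restartLaw hω σ
  have := isMarkovKernel_historyKernel hω
  have := isMarkovKernel_stepKernel hω
  have := isProbabilityMeasure_jumpLaw hω
  refine eq_of_initial_of_step (historyKernel ω) ?_ (map_step_velocityLaw hω σ) fun n => ?_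
  · rw [map_zero_velocityLaw]
    refine Measure.ext_of_lintegral _ fun F hF => ?_
    rw [lintegral_map hF (by fun_prop), lintegral_restartLaw hω σ (by fun_prop)]
    simp [consSeq]
  · refine Measure.ext_of_lintegral _ fun G hG => ?_
    have hm' : Measurable fun q => ∫⁻ y, G (q, y) ∂historyKernel ω n q :=
      hG.lintegral_kernel_prod_right'
    have hm : Measurable fun a : ℕ → RelVel × ℝ =>
        ∫⁻ y, G (Preorder.frestrictLe n a, y) ∂historyKernel ω n (Preorder.frestrictLe n a) :=
      hm'.comp (Preorder.measurable_frestrictLe n)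
    rw [lintegral_map hG (by fun_prop), Measure.lintegral_compProd hG,
      lintegral_map hm' (by fun_prop),
      lintegral_restartLaw hω σ (by fun_prop)]
    refine Eq.trans ?_ (lintegral_restartLaw hω σ hm).symm
    refine lintegral_congr fun p => ?_
    -- For `n = 0` the history is `p` alone, and averaging the first entry of a fresh process over
    -- the jump out of `p.1` gives `stepKernel`. For `n = k + 1` the history is `p` followed by a
    -- history of the tail, and the step is a step of the tail.
    cases n with
    | zero =>
      have h : ∀ m : ℕ → RelVel × ℝ, Preorder.frestrictLe 0 (consSeq p m) = fun _ => p := by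
        intro m
        ext1 ⟨i, hi⟩
        obtain rfl : i = 0 := by simpa using hi
        rfl
      simp only [h, consSeq]
      have hp : Measurable fun y => G (fun _ => p, y) := hG.comp measurable_prodMk_left
      simp_rw [fun τ => lintegral_zero_velocityLaw hω τ hp]
      rw [← lintegral_stepKernel _ hp]
      simp only [lintegral_const, measure_univ, mul_one]
      rfl
    | succ k =>
      refine lintegral_congr fun τ => ?_
      let Ψ : (Π _ : Finset.Iic k, RelVel × ℝ) → (Π _ : Finset.Iic (k + 1), RelVel × ℝ) :=
        fun q i => if h : i.1 = 0 then p else q ⟨i.1 - 1, by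
          have := Finset.mem_Iic.1 i.2
          exact Finset.mem_Iic.2 (by omega)⟩
      have hΨ : Measurable Ψ := by
        refine measurable_pi_lambda _ fun i => ?_
        by_cases h : i.1 = 0
        · simp only [Ψ, h, dite_true]; fun_prop
        · simp only [Ψ, h, dite_false]; fun_prop
      have h : ∀ m : ℕ → RelVel × ℝ, Preorder.frestrictLe (k + 1) (consSeq p m) =
          Ψ (Preorder.frestrictLe k m) := by
        intro m
        ext1 ⟨i, hi⟩
        cases i <;> simp [Ψ, consSeq]
      simp only [h, consSeq]
      exact lintegral_step_velocityLaw hω τ k (G := fun q => G (Ψ q.1, q.2)) (by fun_prop)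

/-- The form in which the Markov property is used: an exponential holding time in `σ`, a jump, and
an independent restart. -/
lemma lintegral_velocityLaw (hω : 0 < ω) (σ : RelVel) {F : (ℕ → RelVel × ℝ) → ℝ≥0∞}
    (hF : Measurable F) :
    ∫⁻ m, F m ∂velocityLaw ω hω σ =
      ∫⁻ s, ∫⁻ τ, ∫⁻ m, F (consSeq (σ, s) m) ∂velocityLaw ω hω τ ∂jumpLaw ω σ
        ∂expMeasure (2 * ω) := by
  have := isProbabilityMeasure_expMeasure (r := 2 * ω) (by positivity)
  rw [velocityLaw_eq_restartLaw, lintegral_restartLaw hω σ hF, holdLaw, exitRate_eq,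
    lintegral_prod]
  · rw [lintegral_dirac]
  · simp_rw [← fun p => lintegral_tailKernel hω p (F := fun m => F (consSeq p m))
      (hF.comp (measurable_consSeq.comp measurable_prodMk_left))]
    have := isMarkovKernel_tailKernel hω
    exact ((hF.comp measurable_consSeq).lintegral_kernel_prod_right' (f := fun q =>
      F (consSeq q.1 q.2)) (κ := tailKernel ω hω)).aemeasurable

/-! ### The flow clamped at `0` and the process after its first jump -/

/-- The clamped flow `(x, σ) ↦ (max(0, φ^σ_t(x)), σ)`. -/
def clampedFlow (c v t : ℝ) (z : State) : State := (Real.toNNReal (flow c v z.2 t z.1), z.2)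

lemma measurable_clampedFlow (c v : ℝ) :
    Measurable fun q : ℝ × State => clampedFlow c v q.1 q.2 :=
  (((measurable_flow c v).comp (f := fun q : ℝ × State => (q.2.2, q.1, (q.2.1 : ℝ)))
    (by fun_prop)).real_toNNReal).prodMk (by fun_prop)

lemma jumpTime_consSeq (p : RelVel × ℝ) (m : ℕ → RelVel × ℝ) (n : ℕ) :
    jumpTime (consSeq p m) (n + 1) = p.2 + jumpTime m n := by
  rw [jumpTime, Finset.sum_range_succ', add_comm]
  rfl

lemma jumpIndex_consSeq_of_lt {p : RelVel × ℝ} (m : ℕ → RelVel × ℝ) {t : ℝ} (ht : t < p.2) :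
    jumpIndex (consSeq p m) t = 0 := by
  refine Nat.sInf_eq_zero.2 (Or.inl ?_)
  simpa [jumpTime, consSeq] using ht

/-- Prepending an entry delays all jumps by `p.2` and shifts the indices by one. If no jump time
exceeded `t`, both infima would be over the empty set and equal to the default 0, and the shift
would fail; hence `hm`. -/
lemma jumpIndex_consSeq_of_le {p : RelVel × ℝ} {m : ℕ → RelVel × ℝ} {t : ℝ} (ht : p.2 ≤ t)
    (hm : ∃ n, t - p.2 < jumpTime m (n + 1)) :
    jumpIndex (consSeq p m) t = jumpIndex m (t - p.2) + 1 := by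
  have h0 : 0 ∉ {n | t < jumpTime (consSeq p m) (n + 1)} := by
    simpa [jumpTime, consSeq] using ht
  have hs : ∀ n, n + 1 ∈ {n | t < jumpTime (consSeq p m) (n + 1)} ↔
      n ∈ {n | t - p.2 < jumpTime m (n + 1)} := by
    intro n
    simp [jumpTime_consSeq, sub_lt_iff_lt_add']
  unfold jumpIndex
  refine le_antisymm (Nat.sInf_le ((hs _).2 (Nat.sInf_mem hm))) ?_
  have hne : {n | t < jumpTime (consSeq p m) (n + 1)}.Nonempty :=
    let ⟨n, hn⟩ := hm
    ⟨n + 1, (hs n).2 hn⟩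
  have hmem := Nat.sInf_mem hne
  rcases hk : sInf {n | t < jumpTime (consSeq p m) (n + 1)} with _ | k
  · exact absurd (hk ▸ hmem) h0
  · exact Nat.succ_le_succ (Nat.sInf_le ((hs k).1 (hk ▸ hmem)))

variable {c v : ℝ}

lemma positionAtJump_consSeq (x : ℝ≥0) (p : RelVel × ℝ) (m : ℕ → RelVel × ℝ) (n : ℕ) :
    positionAtJump c v x (consSeq p m) (n + 1) =
      positionAtJump c v (clampedFlow c v p.2 (x, p.1)).1 m n := by
  induction n with
  | zero => simp [positionAtJump, jumpTime, clampedFlow, consSeq]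
  | succ n ih =>
    rw [positionAtJump, ih, jumpTime_consSeq, jumpTime_consSeq, positionAtJump,
      add_sub_add_left_eq_sub]
    rfl

lemma process_consSeq_of_lt {p : RelVel × ℝ} (m : ℕ → RelVel × ℝ) (x : ℝ≥0) {t : ℝ}
    (ht : t < p.2) : process c v t x (consSeq p m) = clampedFlow c v t (x, p.1) := by
  simp [process, jumpIndex_consSeq_of_lt m ht, clampedFlow, jumpTime, positionAtJump, consSeq]

lemma process_consSeq_of_le {p : RelVel × ℝ} {m : ℕ → RelVel × ℝ} (x : ℝ≥0) {t : ℝ}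
    (ht : p.2 ≤ t) (hm : ∃ n, t - p.2 < jumpTime m (n + 1)) :
    process c v t x (consSeq p m) =
      process c v (t - p.2) (clampedFlow c v p.2 (x, p.1)).1 m := by
  simp only [process, jumpIndex_consSeq_of_le ht hm, positionAtJump_consSeq, jumpTime_consSeq,
    sub_add_eq_sub_sub]
  rfl

/-! ### Joint measurability -/

lemma measurable_jumpIndex_uncurry :
    Measurable fun q : ℝ × (ℕ → RelVel × ℝ) => jumpIndex q.2 q.1 := by
  have hT := measurable_jumpTime
  refine measurable_of_Iic fun n => ?_
  have h : (fun q : ℝ × (ℕ → RelVel × ℝ) => jumpIndex q.2 q.1) ⁻¹' Set.Iic n =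
      (⋃ k ∈ Set.Iic n, {q | q.1 < jumpTime q.2 (k + 1)}) ∪
        ⋂ k, {q | q.1 < jumpTime q.2 (k + 1)}ᶜ := by
    ext ⟨t, m⟩
    simp only [Set.mem_preimage, Set.mem_Iic, Set.mem_union, Set.mem_iUnion, Set.mem_iInter,
      Set.mem_ofPred_eq, Set.mem_compl_iff, jumpIndex, exists_prop]
    constructor
    · intro hn
      by_cases hne : ∃ k, t < jumpTime m (k + 1)
      · exact Or.inl ⟨_, hn, Nat.sInf_mem (s := {n | t < jumpTime m (n + 1)}) hne⟩
      · exact Or.inr fun k hk => hne ⟨k, hk⟩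
    · rintro (⟨k, hk, hkt⟩ | hall)
      · exact (Nat.sInf_le (s := {n | t < jumpTime m (n + 1)}) hkt).trans hk
      · have : {n | t < jumpTime m (n + 1)} = ∅ := Set.eq_empty_of_forall_notMem hall
        simp [this]
  rw [h]
  have hm : ∀ k, MeasurableSet {q : ℝ × (ℕ → RelVel × ℝ) | q.1 < jumpTime q.2 (k + 1)} :=
    fun k => measurableSet_lt measurable_fst ((hT _).comp measurable_snd)
  exact (MeasurableSet.biUnion (Set.to_countable _) fun k _ => hm k).union
    (MeasurableSet.iInter fun k => (hm k).compl)

lemma measurable_process_uncurry (c v : ℝ) :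
    Measurable fun q : (ℝ × ℝ≥0) × (ℕ → RelVel × ℝ) => process c v q.1.1 q.1.2 q.2 := by
  have key : Measurable fun q : ((ℝ × ℝ≥0) × (ℕ → RelVel × ℝ)) × ℕ =>
      clampedFlow c v (q.1.1.1 - jumpTime q.1.2 q.2)
        (positionAtJump c v q.1.1.2 q.1.2 q.2, (q.1.2 q.2).1) := by
    refine measurable_from_prod_countable_left fun n => ?_
    have h1 := measurable_jumpTime n
    have h2 : Measurable fun q : (ℝ × ℝ≥0) × (ℕ → RelVel × ℝ) => positionAtJump c v q.1.2 q.2 n :=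
      (measurable_positionAtJump c v n).comp (g := fun p : ℝ≥0 × (ℕ → RelVel × ℝ) =>
        positionAtJump c v p.1 p.2 n)
        (f := fun q : (ℝ × ℝ≥0) × (ℕ → RelVel × ℝ) => (q.1.2, q.2)) (by fun_prop)
    exact (measurable_clampedFlow c v).comp (f := fun q : (ℝ × ℝ≥0) × (ℕ → RelVel × ℝ) =>
      (q.1.1 - jumpTime q.2 n, (positionAtJump c v q.1.2 q.2 n, (q.2 n).1))) (by fun_prop)
  have h : Measurable fun q : (ℝ × ℝ≥0) × (ℕ → RelVel × ℝ) => jumpIndex q.2 q.1.1 :=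
    measurable_jumpIndex_uncurry.comp (f := fun q : (ℝ × ℝ≥0) × (ℕ → RelVel × ℝ) =>
      (q.1.1, q.2)) (by fun_prop)
  exact key.comp (f := fun q : (ℝ × ℝ≥0) × (ℕ → RelVel × ℝ) => (q, jumpIndex q.2 q.1.1))
    (by fun_prop)

lemma isMarkovKernel_transition (hω : 0 < ω) (t : ℝ) :
    IsMarkovKernel (transition ω c v hω t) := by
  refine ⟨fun z => ?_⟩
  have := isProbabilityMeasure_velocityLaw hω z.2
  exact Measure.isProbabilityMeasure_map
    ((measurable_process c v t).comp measurable_prodMk_left).aemeasurable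

lemma lintegral_transition (hω : 0 < ω) (t : ℝ) (z : State) {f : State → ℝ≥0∞}
    (hf : Measurable f) :
    ∫⁻ y, f y ∂transition ω c v hω t z =
      ∫⁻ m, f (process c v t z.1 m) ∂velocityLaw ω hω z.2 :=
  lintegral_map hf ((measurable_process c v t).comp measurable_prodMk_left)

/-- Joint version, with function, time and starting point all depending on a parameter, as they do
under the time integrals of the renewal equations. -/
lemma measurable_lintegral_transition (hω : 0 < ω) {α : Type*} [MeasurableSpace α]
    {F : α → State → ℝ≥0∞} (hF : Measurable (Function.uncurry F)) {t : α → ℝ} (ht : Measurable t)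
    {Z : α → State} (hZ : Measurable Z) :
    Measurable fun a => ∫⁻ y, F a y ∂transition ω c v hω (t a) (Z a) := by
  let κ : Kernel α (ℕ → RelVel × ℝ) :=
    (Kernel.ofFunOfCountable (velocityLaw ω hω)).comap (fun a => (Z a).2) (by fun_prop)
  have : IsMarkovKernel κ := ⟨fun a => isProbabilityMeasure_velocityLaw hω (Z a).2⟩
  simp_rw [fun a => lintegral_transition (c := c) (v := v) hω (t a) (Z a)
    (f := F a) (hF.comp measurable_prodMk_left)]
  have hp : Measurable fun q : α × (ℕ → RelVel × ℝ) => process c v (t q.1) (Z q.1).1 q.2 :=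
    (measurable_process_uncurry c v).comp (f := fun q : α × (ℕ → RelVel × ℝ) =>
      ((t q.1, (Z q.1).1), q.2)) (by fun_prop)
  exact Measurable.lintegral_kernel_prod_right' (κ := κ)
    (f := fun q => F q.1 (process c v (t q.1) (Z q.1).1 q.2))
    (hF.comp (measurable_fst.prodMk hp))

lemma measurable_lintegral_jumpLaw (hω : 0 < ω) {α : Type*} [MeasurableSpace α]
    {F : α → RelVel → ℝ≥0∞} (hF : Measurable (Function.uncurry F)) {σ : α → RelVel}
    (hσ : Measurable σ) : Measurable fun a => ∫⁻ τ, F a τ ∂jumpLaw ω (σ a) := by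
  let κ : Kernel α RelVel := (Kernel.ofFunOfCountable (jumpLaw ω)).comap σ hσ
  have : IsMarkovKernel κ := ⟨fun a => isProbabilityMeasure_jumpLaw hω (σ a)⟩
  exact Measurable.lintegral_kernel_prod_right' (κ := κ) hF

/-! ### Contraction principle and exponential holding times -/

/-- A bound `u ≤ w + C` that every step improves by a factor `q < 1` holds with `C = 0`. -/
lemma le_of_contraction {ι : Type*} {u w : ι → ℝ≥0∞} {q C : ℝ≥0∞} (hq : q < 1) (hC : C ≠ ∞)
    (h0 : ∀ i, u i ≤ w i + C)
    (hstep : ∀ M, (∀ i, u i ≤ w i + M) → ∀ i, u i ≤ w i + q * M) (i : ι) : u i ≤ w i := by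
  have h : ∀ n : ℕ, ∀ i, u i ≤ w i + q ^ n * C := by
    intro n
    induction n with
    | zero => simpa using h0
    | succ n ih => simpa [pow_succ', mul_assoc] using hstep _ ih
  have hlim : Filter.Tendsto (fun n : ℕ => w i + q ^ n * C) Filter.atTop (nhds (w i + 0 * C)) :=
    (ENNReal.Tendsto.mul_const (ENNReal.tendsto_pow_atTop_nhds_zero_of_lt_one hq)
      (Or.inr hC)).const_add _
  simpa using ge_of_tendsto' hlim fun n => h n i

/-- The probability that the velocity does not change before time `t`. -/
def survival (ω t : ℝ) : ℝ≥0∞ := ENNReal.ofReal (Real.exp (-(2 * ω * t)))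

lemma measurable_survival (ω : ℝ) : Measurable (survival ω) := by
  unfold survival
  fun_prop

lemma survival_mul_survival (ω s t : ℝ) :
    survival ω s * survival ω t = survival ω (s + t) := by
  rw [survival, survival, survival, ← ENNReal.ofReal_mul (Real.exp_nonneg _), ← Real.exp_add]
  ring_nf

lemma survival_ne_top (ω t : ℝ) : survival ω t ≠ ∞ := ENNReal.ofReal_ne_top

lemma expMeasure_Iic (hω : 0 < ω) {t : ℝ} (ht : 0 ≤ t) :
    expMeasure (2 * ω) (Set.Iic t) = 1 - survival ω t := by
  have h := lintegral_exponentialPDF_eq_antiDeriv (r := 2 * ω) (by positivity) t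
  rw [if_pos ht, ENNReal.ofReal_sub _ (Real.exp_nonneg _), ENNReal.ofReal_one] at h
  rw [survival, ← h, expMeasure, gammaMeasure, withDensity_apply _ measurableSet_Iic]
  rfl

lemma survival_le_one (hω : 0 < ω) {t : ℝ} (ht : 0 ≤ t) : survival ω t ≤ 1 := by
  rw [survival, ENNReal.ofReal_le_one, Real.exp_le_one_iff]
  have := mul_nonneg hω.le ht
  linarith

lemma expMeasure_Ioi (hω : 0 < ω) {t : ℝ} (ht : 0 ≤ t) :
    expMeasure (2 * ω) (Set.Ioi t) = survival ω t := by
  have := isProbabilityMeasure_expMeasure (r := 2 * ω) (by positivity)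
  rw [← Set.compl_Iic, prob_compl_eq_one_sub measurableSet_Iic, expMeasure_Iic hω ht]
  exact ENNReal.sub_sub_cancel ENNReal.one_ne_top (survival_le_one hω ht)

/-- The exponential density vanishes on the negative half-line, so only [0, t] contributes. -/
lemma setLIntegral_expMeasure_Iic (hω : 0 < ω) (t : ℝ) {F : ℝ → ℝ≥0∞} (hF : Measurable F) :
    ∫⁻ s in Set.Iic t, F s ∂expMeasure (2 * ω) =
      ∫⁻ s in Set.Icc 0 t, ENNReal.ofReal (2 * ω) * survival ω s * F s := by
  have hpdf : Measurable (exponentialPDF (2 * ω)) :=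
    (measurable_exponentialPDFReal _).ennreal_ofReal
  change ∫⁻ s in Set.Iic t, F s ∂volume.withDensity (exponentialPDF (2 * ω)) = _
  rw [setLIntegral_withDensity_eq_setLIntegral_mul _ hpdf hF measurableSet_Iic,
    ← lintegral_indicator measurableSet_Iic, ← lintegral_indicator measurableSet_Icc]
  refine lintegral_congr fun s => ?_
  by_cases hs : 0 ≤ s
  · by_cases hst : s ≤ t
    · rw [Set.indicator_of_mem (by exact hst), Set.indicator_of_mem (by exact ⟨hs, hst⟩),
        Pi.mul_apply, exponentialPDF_of_nonneg hs, ENNReal.ofReal_mul (by positivity)]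
      rfl
    · rw [Set.indicator_of_notMem (by exact hst),
        Set.indicator_of_notMem (by exact fun h => hst h.2)]
  · rw [Set.indicator_of_notMem (s := Set.Icc 0 t) (by exact fun h => hs h.1)]
    refine Set.indicator_apply_eq_zero.2 fun _ => ?_
    rw [Pi.mul_apply, exponentialPDF_of_neg (not_le.1 hs), zero_mul]

/-- The mass of the renewal kernel, which is the contraction factor in all uniqueness arguments
below. -/
lemma setLIntegral_survival (hω : 0 < ω) {t : ℝ} (ht : 0 ≤ t) :
    ∫⁻ s in Set.Icc 0 t, ENNReal.ofReal (2 * ω) * survival ω s = 1 - survival ω t := by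
  have h := setLIntegral_expMeasure_Iic hω t (F := fun _ => 1) measurable_const
  simpa [expMeasure_Iic hω ht] using h.symm

lemma one_sub_survival_lt_one (ω t : ℝ) : 1 - survival ω t < 1 :=
  ENNReal.sub_lt_self ENNReal.one_ne_top one_ne_zero
    (by simpa [survival] using Real.exp_pos _)

lemma one_sub_survival_mono (hω : 0 < ω) {s t : ℝ} (h : s ≤ t) :
    1 - survival ω s ≤ 1 - survival ω t := by
  refine tsub_le_tsub_left (ENNReal.ofReal_le_ofReal (Real.exp_le_exp.2 ?_)) 1
  have := mul_le_mul_of_nonneg_left h hω.le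
  linarith

lemma measurable_lintegral_velocityLaw (hω : 0 < ω) {α : Type*} [MeasurableSpace α]
    {F : α → (ℕ → RelVel × ℝ) → ℝ≥0∞} (hF : Measurable (Function.uncurry F)) {σ : α → RelVel}
    (hσ : Measurable σ) : Measurable fun a => ∫⁻ m, F a m ∂velocityLaw ω hω (σ a) := by
  let κ : Kernel α (ℕ → RelVel × ℝ) := (Kernel.ofFunOfCountable (velocityLaw ω hω)).comap σ hσ
  have : IsMarkovKernel κ := ⟨fun a => isProbabilityMeasure_velocityLaw hω (σ a)⟩
  exact Measurable.lintegral_kernel_prod_right' (κ := κ) hF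

lemma measurable_lintegral_consSeq (hω : 0 < ω) (σ : RelVel) {F : (ℕ → RelVel × ℝ) → ℝ≥0∞}
    (hF : Measurable F) :
    Measurable fun s : ℝ => ∫⁻ τ, ∫⁻ m, F (consSeq (σ, s) m) ∂velocityLaw ω hω τ ∂jumpLaw ω σ := by
  refine measurable_lintegral_jumpLaw hω
    (F := fun s τ => ∫⁻ m, F (consSeq (σ, s) m) ∂velocityLaw ω hω τ)
    (measurable_lintegral_velocityLaw hω (α := ℝ × RelVel)
      (F := fun q m => F (consSeq (σ, q.1) m)) ?_ measurable_snd) measurable_const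
  exact hF.comp (measurable_consSeq.comp (f := fun q : (ℝ × RelVel) × (ℕ → RelVel × ℝ) =>
    ((σ, q.1.1), q.2)) (by fun_prop))

/-! ### Non-explosion -/

/-- The velocity process has finitely many jumps in finite time. -/
lemma ae_exists_lt_jumpTime (hω : 0 < ω) (σ : RelVel) (t : ℝ) :
    ∀ᵐ m ∂velocityLaw ω hω σ, ∃ n, t < jumpTime m (n + 1) := by
  have hprob := isProbabilityMeasure_velocityLaw hω
  have hjump := isProbabilityMeasure_jumpLaw hω
  let A : ℝ → Set (ℕ → RelVel × ℝ) := fun t => {m | ∀ n, jumpTime m (n + 1) ≤ t}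
  have hA : ∀ t, MeasurableSet (A t) := fun t => by
    have h : A t = ⋂ n, {m | jumpTime m (n + 1) ≤ t} := by ext; simp [A]
    rw [h]
    exact MeasurableSet.iInter fun n => measurableSet_le (measurable_jumpTime _) measurable_const
  -- If all jumps occur by time `r ≤ |t|`, then the first holding time `s` is at most `|t|`, and the
  -- restarted process has all its jumps by `r - s ≤ |t|`. A uniform bound `M` thus improves to `(1
  -- - survival ω |t|) * M`. Using `|t|` keeps the horizon nonnegative while `r` may become
  -- negative.
  have hbound : ∀ i : {r : ℝ // r ≤ |t|} × RelVel,
      velocityLaw ω hω i.2 (A i.1) ≤ (fun _ => 0) i := by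
    refine le_of_contraction (one_sub_survival_lt_one ω |t|) ENNReal.one_ne_top
      (fun i => by simpa using prob_le_one) ?_
    rintro M hM ⟨⟨r, hr⟩, σ⟩
    simp only [zero_add] at hM ⊢
    have hI : Measurable ((A r).indicator (fun _ => (1 : ℝ≥0∞))) :=
      measurable_const.indicator (hA r)
    have hIoi : ∫⁻ s in Set.Ioi |t|, ∫⁻ τ, ∫⁻ m, (A r).indicator (fun _ => (1 : ℝ≥0∞))
        (consSeq (σ, s) m) ∂velocityLaw ω hω τ ∂jumpLaw ω σ ∂expMeasure (2 * ω) = 0 := by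
      rw [setLIntegral_congr_fun (g := fun _ => 0) measurableSet_Ioi]
      · simp
      · intro s hs
        have h : ∀ m, consSeq (σ, s) m ∉ A r := fun m hm => by
          have := hm 0
          simp [jumpTime, consSeq] at this
          have hs' : |t| < s := hs
          linarith
        simp [h]
    rw [← lintegral_indicator_one (hA r), Pi.one_def, lintegral_velocityLaw hω σ hI,
      ← lintegral_add_compl _ (measurableSet_Iic (a := |t|)), Set.compl_Iic, hIoi, add_zero,
      setLIntegral_expMeasure_Iic hω _ (measurable_lintegral_consSeq hω σ hI),
      ← setLIntegral_survival hω (abs_nonneg t), ← lintegral_mul_const _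
        ((measurable_survival ω).const_mul _)]
    refine setLIntegral_mono' measurableSet_Icc fun s hs => mul_le_mul_right ?_ _
    calc ∫⁻ τ, ∫⁻ m, (A r).indicator (fun _ => (1 : ℝ≥0∞)) (consSeq (σ, s) m)
          ∂velocityLaw ω hω τ ∂jumpLaw ω σ
        ≤ ∫⁻ τ, M ∂jumpLaw ω σ := lintegral_mono fun τ => ?_
      _ = M := by simp
    refine le_trans (lintegral_mono (g := (A (r - s)).indicator 1) fun m => ?_) ?_
    · have hsub : consSeq (σ, s) ⁻¹' A r ⊆ A (r - s) := fun m hm n => by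
        have := hm (n + 1)
        rw [jumpTime_consSeq] at this
        linarith
      exact Set.indicator_le_indicator_of_subset (f := fun _ => (1 : ℝ≥0∞)) hsub
        (fun _ => zero_le) m
    · rw [lintegral_indicator_one (hA _)]
      exact hM (⟨r - s, by have := hs.1; linarith⟩, τ)
  have h := hbound (⟨t, le_abs_self t⟩, σ)
  rw [ae_iff]
  simpa [A] using h

/-! ### Renewal equations at the first and at the last jump -/

/-- The effect on functions of a jump of the velocity. -/
def jumpOp (ω : ℝ) (f : State → ℝ≥0∞) (z : State) : ℝ≥0∞ := ∫⁻ τ, f (z.1, τ) ∂jumpLaw ω z.2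

lemma measurable_jumpOp (hω : 0 < ω) {α : Type*} [MeasurableSpace α]
    {F : α → State → ℝ≥0∞} (hF : Measurable (Function.uncurry F)) {Z : α → State}
    (hZ : Measurable Z) : Measurable fun a => jumpOp ω (F a) (Z a) :=
  measurable_lintegral_jumpLaw hω (F := fun a τ => F a ((Z a).1, τ))
    (hF.comp (f := fun q : α × RelVel => (q.1, ((Z q.1).1, q.2))) (by fun_prop)) (by fun_prop)

/-- The renewal equation obtained by conditioning on the first jump. -/
lemma lintegral_transition_eq_first_jump (hω : 0 < ω) {t : ℝ} (ht : 0 ≤ t) {f : State → ℝ≥0∞}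
    (hf : Measurable f) (z : State) :
    ∫⁻ y, f y ∂transition ω c v hω t z = survival ω t * f (clampedFlow c v t z) +
      ∫⁻ s in Set.Icc 0 t, ENNReal.ofReal (2 * ω) * survival ω s *
        jumpOp ω (fun w => ∫⁻ y, f y ∂transition ω c v hω (t - s) w) (clampedFlow c v s z) := by
  obtain ⟨x, σ⟩ := z
  have hprob := isProbabilityMeasure_velocityLaw hω
  have hjump := isProbabilityMeasure_jumpLaw hω
  have hF : Measurable fun m => f (process c v t x m) :=
    hf.comp ((measurable_process c v t).comp measurable_prodMk_left)
  rw [lintegral_transition hω t _ hf, lintegral_velocityLaw hω σ hF,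
    ← lintegral_add_compl _ (measurableSet_Iic (a := t)), Set.compl_Iic, add_comm]
  congr 1
  · rw [setLIntegral_congr_fun (g := fun _ => f (clampedFlow c v t (x, σ))) measurableSet_Ioi]
    · rw [setLIntegral_const, expMeasure_Ioi hω ht, mul_comm]
    · intro s hs
      simp [process_consSeq_of_lt (p := (σ, s)) _ x hs]
  · rw [setLIntegral_expMeasure_Iic hω t (measurable_lintegral_consSeq hω σ hF)]
    refine setLIntegral_congr_fun measurableSet_Icc fun s hs => ?_
    congr 1
    refine lintegral_congr fun τ => ?_
    refine Eq.trans ?_ (lintegral_transition hω _ _ hf).symm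
    refine lintegral_congr_ae ?_
    -- The restart identity for `process` needs the default value of `jumpIndex` to be avoided,
    -- which non-explosion ensures almost surely.
    filter_upwards [ae_exists_lt_jumpTime hω τ (t - s)] with m hm
    rw [process_consSeq_of_le (p := (σ, s)) x hs.2 hm]

lemma jumpOp_mono {f g : State → ℝ≥0∞} (h : ∀ z, f z ≤ g z) (z : State) :
    jumpOp ω f z ≤ jumpOp ω g z := lintegral_mono fun _ => h _

lemma jumpOp_const (hω : 0 < ω) (M : ℝ≥0∞) (z : State) : jumpOp ω (fun _ => M) z = M := by
  have := isProbabilityMeasure_jumpLaw hω z.2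
  simp [jumpOp]

lemma jumpOp_add {f g : State → ℝ≥0∞} (hg : Measurable g) (z : State) :
    jumpOp ω (fun y => f y + g y) z = jumpOp ω f z + jumpOp ω g z :=
  lintegral_add_right _ (hg.comp measurable_prodMk_left)

lemma jumpOp_const_mul {f : State → ℝ≥0∞} (hf : Measurable f) (a : ℝ≥0∞) (z : State) :
    jumpOp ω (fun y => a * f y) z = a * jumpOp ω f z :=
  lintegral_const_mul _ (hf.comp measurable_prodMk_left)

lemma jumpOp_lintegral (hω : 0 < ω) {F : ℝ → State → ℝ≥0∞}
    (hF : Measurable (Function.uncurry F)) (μ : Measure ℝ) [SFinite μ] (z : State) :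
    jumpOp ω (fun y => ∫⁻ r, F r y ∂μ) z = ∫⁻ r, jumpOp ω (F r) z ∂μ := by
  have := isProbabilityMeasure_jumpLaw hω z.2
  refine lintegral_lintegral_swap (f := fun τ r => F r (z.1, τ)) (Measurable.aemeasurable ?_)
  exact hF.comp (f := fun q : RelVel × ℝ => (q.2, (z.1, q.1))) (by fun_prop)

/-- Bounded solutions of the renewal equation are minimal. -/
lemma le_of_renewal (hω : 0 < ω) {a u w : ℝ → State → ℝ≥0∞}
    (hu : ∀ t, 0 ≤ t → ∀ z, u t z = a t z + ∫⁻ s in Set.Icc 0 t,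
      ENNReal.ofReal (2 * ω) * survival ω s * jumpOp ω (u (t - s)) (clampedFlow c v s z))
    (hw : ∀ t, 0 ≤ t → ∀ z, w t z = a t z + ∫⁻ s in Set.Icc 0 t,
      ENNReal.ofReal (2 * ω) * survival ω s * jumpOp ω (w (t - s)) (clampedFlow c v s z))
    {T : ℝ} {C : ℝ≥0∞} (hC : C ≠ ∞) (hbound : ∀ t ∈ Set.Icc 0 T, ∀ z, u t z ≤ C)
    {t : ℝ} (ht : t ∈ Set.Icc 0 T) (z : State) : u t z ≤ w t z := by
  -- The inhomogeneous terms agree and `jumpOp` is monotone and preserves constants, so `u ≤ w + M`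
  -- on [0, T] passes through the equation with factor at most `1 - survival ω T`. Only `u` has to
  -- be bounded.
  refine le_of_contraction (ι := Set.Icc 0 T × State) (u := fun i => u i.1 i.2)
    (w := fun i => w i.1 i.2) (one_sub_survival_lt_one ω T) hC
    (fun i => (hbound _ i.1.2 _).trans le_add_self) ?_ (⟨t, ht⟩, z)
  rintro M hM ⟨⟨r, hr⟩, y⟩
  have hk := (measurable_survival ω).const_mul (ENNReal.ofReal (2 * ω))
  simp only
  rw [hu r hr.1, hw r hr.1, add_assoc]
  refine add_le_add_right ?_ _
  calc _ ≤ ∫⁻ s in Set.Icc 0 r, (ENNReal.ofReal (2 * ω) * survival ω s *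
            jumpOp ω (w (r - s)) (clampedFlow c v s y) +
            ENNReal.ofReal (2 * ω) * survival ω s * M) := by
        refine setLIntegral_mono' measurableSet_Icc fun s hs => ?_
        rw [← mul_add]
        refine mul_le_mul_right ?_ _
        rw [← jumpOp_const hω M (clampedFlow c v s y), ← jumpOp_add measurable_const]
        exact jumpOp_mono (fun x => hM (⟨r - s, by linarith [hs.2], by linarith [hs.1, hr.2]⟩, x)) _
    _ = _ + (1 - survival ω r) * M := by
        rw [lintegral_add_right _ (hk.mul_const M), lintegral_mul_const _ hk,
          setLIntegral_survival hω hr.1]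
    _ ≤ _ := add_le_add_right (mul_le_mul_left (one_sub_survival_mono hω hr.2) _) _

/-- Tonelli on the triangle 0 ≤ q ≤ s ≤ t, followed by the translation s = q + r. -/
lemma lintegral_triangle {K : ℝ → ℝ → ℝ≥0∞} (hK : Measurable (Function.uncurry K)) (t : ℝ) :
    ∫⁻ s in Set.Icc 0 t, ∫⁻ q in Set.Icc 0 s, K q s =
      ∫⁻ q in Set.Icc 0 t, ∫⁻ r in Set.Icc 0 (t - q), K q (q + r) := by
  let D : Set (ℝ × ℝ) := {p | 0 ≤ p.1 ∧ p.1 ≤ p.2 ∧ p.2 ≤ t}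
  have hD : MeasurableSet D := by
    refine (measurableSet_le measurable_const measurable_fst).inter
      ((measurableSet_le measurable_fst measurable_snd).inter
        (measurableSet_le measurable_snd measurable_const))
  have hL : ∫⁻ s in Set.Icc 0 t, ∫⁻ q in Set.Icc 0 s, K q s =
      ∫⁻ s, ∫⁻ q, D.indicator (Function.uncurry K) (q, s) := by
    rw [← lintegral_indicator measurableSet_Icc]
    refine lintegral_congr fun s => ?_
    by_cases hs : s ∈ Set.Icc 0 t
    · rw [Set.indicator_of_mem hs, ← lintegral_indicator measurableSet_Icc]
      refine lintegral_congr fun q => ?_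
      have : q ∈ Set.Icc 0 s ↔ (q, s) ∈ D := ⟨fun h => ⟨h.1, h.2, hs.2⟩, fun h => ⟨h.1, h.2.1⟩⟩
      by_cases hq : q ∈ Set.Icc 0 s
      · rw [Set.indicator_of_mem hq, Set.indicator_of_mem (this.1 hq)]; rfl
      · rw [Set.indicator_of_notMem hq, Set.indicator_of_notMem (mt this.2 hq)]
    · rw [Set.indicator_of_notMem hs, eq_comm, lintegral_eq_zero_iff (by fun_prop)]
      refine Filter.Eventually.of_forall fun q => ?_
      exact Set.indicator_of_notMem (fun h => hs ⟨h.1.trans h.2.1, h.2.2⟩) _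
  have hR : ∫⁻ q in Set.Icc 0 t, ∫⁻ r in Set.Icc 0 (t - q), K q (q + r) =
      ∫⁻ q, ∫⁻ s, D.indicator (Function.uncurry K) (q, s) := by
    rw [← lintegral_indicator measurableSet_Icc]
    refine lintegral_congr fun q => ?_
    rw [← lintegral_add_left_eq_self _ q]
    by_cases hq : q ∈ Set.Icc 0 t
    · rw [Set.indicator_of_mem hq, ← lintegral_indicator measurableSet_Icc]
      refine lintegral_congr fun r => ?_
      have : r ∈ Set.Icc 0 (t - q) ↔ (q, q + r) ∈ D :=
        ⟨fun h => ⟨hq.1, by linarith [h.1], by linarith [h.2]⟩,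
          fun h => ⟨by linarith [h.2.1], by linarith [h.2.2]⟩⟩
      by_cases hr : r ∈ Set.Icc 0 (t - q)
      · rw [Set.indicator_of_mem hr, Set.indicator_of_mem (this.1 hr)]; rfl
      · rw [Set.indicator_of_notMem hr, Set.indicator_of_notMem (mt this.2 hr)]
    · rw [Set.indicator_of_notMem hq, eq_comm, lintegral_eq_zero_iff (by fun_prop)]
      refine Filter.Eventually.of_forall fun r => ?_
      exact Set.indicator_of_notMem (fun h => hq ⟨h.1, h.2.1.trans h.2.2⟩) _
  rw [hL, hR]
  exact lintegral_lintegral_swap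
    ((hK.indicator hD).comp measurable_swap).aemeasurable

/-- The renewal equation obtained by conditioning on the last jump. -/
lemma lintegral_transition_eq_last_jump (hω : 0 < ω) {t : ℝ} (ht : 0 ≤ t) {f : State → ℝ≥0∞}
    (hf : Measurable f) (hf1 : ∀ z, f z ≤ 1) (z : State) :
    ∫⁻ y, f y ∂transition ω c v hω t z = survival ω t * f (clampedFlow c v t z) +
      ∫⁻ s in Set.Icc 0 t, ENNReal.ofReal (2 * ω) * survival ω (t - s) *
        ∫⁻ y, jumpOp ω (fun x => f (clampedFlow c v (t - s) x)) y ∂transition ω c v hω s z := by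
  have hmk := isMarkovKernel_transition (c := c) (v := v) hω
  have hsv := measurable_survival ω
  have hΦ := measurable_clampedFlow c v
  set lam := ENNReal.ofReal (2 * ω)
  let G : ℝ → State → ℝ≥0∞ := fun r y => jumpOp ω (fun x => f (clampedFlow c v r x)) y
  have hG : Measurable (Function.uncurry G) :=
    measurable_jumpOp hω (F := fun (q : ℝ × State) x => f (clampedFlow c v q.1 x))
      (hf.comp (hΦ.comp (f := fun q : (ℝ × State) × State => (q.1.1, q.2)) (by fun_prop)))
      measurable_snd
  have hPG : Measurable fun q : ℝ × ℝ × State =>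
      ∫⁻ y, G q.1 y ∂transition ω c v hω q.2.1 q.2.2 :=
    measurable_lintegral_transition hω (α := ℝ × ℝ × State) (F := fun q => G q.1)
      (hG.comp (f := fun q : (ℝ × ℝ × State) × State => (q.1.1, q.2)) (by fun_prop))
      (by fun_prop) (by fun_prop)
  -- The right-hand side of the claim. It is shown to solve the first-jump equation as well, and
  -- then compared with the semigroup.
  let u : ℝ → State → ℝ≥0∞ := fun t z => survival ω t * f (clampedFlow c v t z) +
    ∫⁻ s in Set.Icc 0 t, lam * survival ω (t - s) * ∫⁻ y, G (t - s) y ∂transition ω c v hω s z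
  have hu : ∀ t, 0 ≤ t → ∀ z, u t z = survival ω t * f (clampedFlow c v t z) +
      ∫⁻ s in Set.Icc 0 t, lam * survival ω s * jumpOp ω (u (t - s)) (clampedFlow c v s z) := by
    intro t ht z
    -- Contribution of the paths whose first jump is at `q` and whose last jump, a later one, is at
    -- `s`.
    let K : ℝ → ℝ → ℝ≥0∞ := fun q s => lam * survival ω q * (lam * survival ω (t - s)) *
      jumpOp ω (fun w => ∫⁻ y, G (t - s) y ∂transition ω c v hω (s - q) w) (clampedFlow c v q z)
    have hΦz : Measurable fun s => clampedFlow c v s z := hΦ.comp measurable_prodMk_right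
    have hK : Measurable (Function.uncurry K) := by
      refine Measurable.mul (by fun_prop) (measurable_jumpOp hω (α := ℝ × ℝ)
        (F := fun p w => ∫⁻ y, G (t - p.2) y ∂transition ω c v hω (p.2 - p.1) w) ?_
        (hΦz.comp measurable_fst))
      exact hPG.comp (f := fun p : (ℝ × ℝ) × State => (t - p.1.2, p.1.2 - p.1.1, p.2))
        (by fun_prop)
    have hsplit : ∀ s r, lam * survival ω s * (survival ω r * G r (clampedFlow c v s z)) =
        lam * survival ω (s + r) * G r (clampedFlow c v s z) := fun s r => by
      rw [← survival_mul_survival]; ring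
    have hGr : ∀ r, Measurable (G r) := fun r => hG.comp measurable_prodMk_left
    -- Expand the semigroup up to the last jump `s` by its first jump: either `s` is the only jump,
    -- with weight `lam * survival ω t`, or an earlier first jump `q` gives `K q s`.
    have e1 : ∀ s ∈ Set.Icc 0 t,
        lam * survival ω (t - s) * ∫⁻ y, G (t - s) y ∂transition ω c v hω s z =
          lam * survival ω t * G (t - s) (clampedFlow c v s z) +
            ∫⁻ q in Set.Icc 0 s, K q s := by
      intro s hs
      rw [lintegral_transition_eq_first_jump hω hs.1 (hGr _), mul_add,
        ← lintegral_const_mul' _ _ (ENNReal.mul_ne_top ENNReal.ofReal_ne_top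
          (survival_ne_top _ _))]
      congr 1
      · rw [← mul_assoc, mul_assoc lam, survival_mul_survival, sub_add_cancel]
      · refine lintegral_congr fun q => ?_
        simp only [K]
        ring
    -- The same two contributions, now with the first jump `q` fixed and the last jump at `q + r`.
    -- The one-jump terms match those of `e1`, and the double integrals match by
    -- `lintegral_triangle`.
    have e2 : ∀ q ∈ Set.Icc 0 t, lam * survival ω q * jumpOp ω (u (t - q)) (clampedFlow c v q z) =
        lam * survival ω t * G (t - q) (clampedFlow c v q z) +
          ∫⁻ r in Set.Icc 0 (t - q), K q (q + r) := by
      intro q hq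
      have hf' : ∀ r, Measurable fun x => f (clampedFlow c v r x) := fun r =>
        hf.comp (hΦ.comp measurable_prodMk_left)
      have hI : Measurable (Function.uncurry fun (s : ℝ) (w : State) =>
          lam * survival ω (t - q - s) * ∫⁻ y, G (t - q - s) y ∂transition ω c v hω s w) := by
        refine Measurable.mul (by fun_prop) ?_
        exact hPG.comp (f := fun p : ℝ × State => (t - q - p.1, p.1, p.2)) (by fun_prop)
      rw [jumpOp_add (Measurable.lintegral_prod_left hI), jumpOp_const_mul (hf' _), mul_add,
        jumpOp_lintegral hω hI, ← lintegral_const_mul' _ _ (ENNReal.mul_ne_top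
          ENNReal.ofReal_ne_top (survival_ne_top _ _))]
      congr 1
      · rw [hsplit q (t - q), add_sub_cancel]
      · refine lintegral_congr fun r => ?_
        have hm : Measurable fun w => ∫⁻ y, G (t - q - r) y ∂transition ω c v hω r w :=
          hPG.comp (f := fun w : State => (t - q - r, r, w)) (by fun_prop)
        simp only [K]
        rw [jumpOp_const_mul hm, add_sub_cancel_left, sub_add_eq_sub_sub, mul_assoc (lam * survival ω q)]
    have hdiag : Measurable fun s => lam * survival ω t * G (t - s) (clampedFlow c v s z) :=
      (hG.comp (f := fun s => (t - s, clampedFlow c v s z)) (by fun_prop)).const_mul _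
    simp only [u]
    rw [setLIntegral_congr_fun measurableSet_Icc e1, lintegral_add_left hdiag,
      lintegral_triangle hK, ← lintegral_add_left hdiag,
      ← setLIntegral_congr_fun measurableSet_Icc e2]
  have hP := fun (t : ℝ) (ht : 0 ≤ t) z =>
    lintegral_transition_eq_first_jump (c := c) (v := v) hω ht hf z
  have hG1 : ∀ r y, G r y ≤ 1 := fun r y =>
    (jumpOp_mono (fun _ => hf1 _) y).trans (jumpOp_const hω 1 y).le
  have hint : ∀ {g : State → ℝ≥0∞}, (∀ y, g y ≤ 1) → ∀ s z,
      ∫⁻ y, g y ∂transition ω c v hω s z ≤ 1 := fun hg s z =>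
    (lintegral_mono hg).trans (by simp)
  refine le_antisymm
    (le_of_renewal (T := t) (u := fun t z => ∫⁻ y, f y ∂transition ω c v hω t z) hω hP hu ENNReal.one_ne_top (fun s _ y => hint hf1 s y) ⟨ht, le_rfl⟩ z)
    -- The bound 1 is not yet known for `u`; its two terms are bounded by 1 and by the jump rate
    -- times the length of the interval.
    (le_of_renewal (T := t) (C := 1 + lam * ENNReal.ofReal t) (w := fun t z => ∫⁻ y, f y ∂transition ω c v hω t z) hω hu hP ?_ ?_ ⟨ht, le_rfl⟩ z)
  · exact ENNReal.add_ne_top.2 ⟨ENNReal.one_ne_top,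
      ENNReal.mul_ne_top ENNReal.ofReal_ne_top ENNReal.ofReal_ne_top⟩
  · intro r hr y
    refine add_le_add (mul_le_one' (survival_le_one hω hr.1) (hf1 _)) ?_
    calc _ ≤ ∫⁻ s in Set.Icc 0 r, lam := by
          refine setLIntegral_mono' measurableSet_Icc fun s hs => ?_
          rw [mul_assoc]
          exact mul_le_of_le_one_right' (mul_le_one'
            (survival_le_one hω (by linarith [hs.2])) (hint (hG1 _) _ _))
      _ = lam * ENNReal.ofReal r := by simp
      _ ≤ _ := mul_le_mul_right (ENNReal.ofReal_le_ofReal hr.2) _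

/-! ### Measures with exponential tails -/

/-- The tail `y ↦ B e^{ζ y}` on `(0, ∞)`, extended by the total mass `M` to `(-∞, 0]`. -/
def expTail (ζ B M y : ℝ) : ℝ := if y ≤ 0 then M else B * Real.exp (ζ * y)

lemma measurable_expTail (ζ B M : ℝ) : Measurable (expTail ζ B M) :=
  Measurable.ite measurableSet_Iic measurable_const (by fun_prop)

lemma expTail_nonneg {ζ B M : ℝ} (hB : 0 ≤ B) (hM : 0 ≤ M) (y : ℝ) : 0 ≤ expTail ζ B M y := by
  unfold expTail
  split_ifs
  · exact hM
  · positivity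

lemma expTail_le {ζ B M : ℝ} (hζ : ζ ≤ 0) (hB : 0 ≤ B) (hM : 0 ≤ M) (y : ℝ) :
    expTail ζ B M y ≤ B + M := by
  unfold expTail
  split_ifs with hy
  · linarith
  · have : Real.exp (ζ * y) ≤ 1 := Real.exp_le_one_iff.2
      (mul_nonpos_of_nonpos_of_nonneg hζ (not_le.1 hy).le)
    nlinarith

/-- When the mass equals the tail weight there is no jump at 0; this form makes the continuity
visible. -/
lemma expTail_self_of_nonneg {ζ B : ℝ} (y : ℝ) :
    expTail ζ B B y = B * Real.exp (ζ * max y 0) := by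
  unfold expTail
  split_ifs with hy
  · simp [max_eq_right hy]
  · rw [max_eq_left (not_le.1 hy).le]

lemma integrableOn_expTail {ζ B M k l a t : ℝ} (hζ : ζ ≤ 0) (hB : 0 ≤ B) (hM : 0 ≤ M)
    (hl : 0 ≤ l) :
    IntegrableOn (fun s => l * Real.exp (-(l * s)) * expTail ζ B M (a - s * k))
      (Set.Icc 0 t) := by
  have hm : Measurable fun s => l * Real.exp (-(l * s)) * expTail ζ B M (a - s * k) := by
    have := measurable_expTail ζ B M
    fun_prop
  refine Measure.integrableOn_of_bounded (M := l * (B + M)) (by simp)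
    hm.aestronglyMeasurable ?_
  filter_upwards [ae_restrict_mem measurableSet_Icc] with s hs
  have h0 := expTail_nonneg (ζ := ζ) hB hM (a - s * k)
  have h1 : Real.exp (-(l * s)) ≤ 1 := Real.exp_le_one_iff.2 (by
    have := mul_nonneg hl hs.1
    linarith)
  rw [Real.norm_of_nonneg (by positivity)]
  exact mul_le_mul (mul_le_of_le_one_right hl h1) (expTail_le hζ hB hM _) h0 hl

/-- Balance of the tails along a flow of speed `k` with jump rate `l`. -/
lemma integral_expTail {ζ B B' M k l a t : ℝ} (hζ : ζ ≤ 0) (hB' : 0 ≤ B') (hM : 0 ≤ M)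
    (hl : 0 ≤ l) (ha : 0 < a) (ht : 0 ≤ t) (hbal : (l + ζ * k) * B = l * B')
    (hk : 0 < k → B = M) :
    ∫ s in 0..t, l * Real.exp (-(l * s)) * expTail ζ B' M (a - s * k) =
      expTail ζ B M a - Real.exp (-(l * t)) * expTail ζ B M (a - t * k) := by
  have hcont : ContinuousOn (fun s => -(Real.exp (-(l * s)) * expTail ζ B M (a - s * k)))
      (Set.uIcc 0 t) := by
    -- For `0 < k` the argument `a - s * k` may cross 0, where `expTail` jumps unless `B = M`. For
    -- `k ≤ 0` it stays at least `a > 0`.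
    rcases lt_or_ge 0 k with hk0 | hk0
    · rw [← hk hk0]
      simp only [expTail_self_of_nonneg]
      fun_prop
    · have h : ContinuousOn (fun s => -(Real.exp (-(l * s)) * (B * Real.exp (ζ * (a - s * k)))))
          (Set.uIcc 0 t) := by fun_prop
      refine h.congr fun s hs => ?_
      rw [Set.uIcc_of_le ht] at hs
      have : s * k ≤ 0 := mul_nonpos_of_nonneg_of_nonpos hs.1 hk0
      simp only [expTail]
      rw [if_neg (by linarith)]
  have hexp : ∀ s, HasDerivAt (fun s => Real.exp (-(l * s))) (-(l * Real.exp (-(l * s)))) s := by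
    intro s
    have := ((hasDerivAt_id s).const_mul l).neg.exp
    simpa [mul_comm] using this
  -- The only possible kink is where the argument vanishes, at `s = a / k`. Below 0 both tails are
  -- the constant `M`; above 0 the derivative is the integrand by `hbal`.
  have hder : ∀ s ∈ Set.Ioo (min 0 t) (max 0 t) \ {a / k},
      HasDerivAt (fun s => -(Real.exp (-(l * s)) * expTail ζ B M (a - s * k)))
        (l * Real.exp (-(l * s)) * expTail ζ B' M (a - s * k)) s := by
    rintro s ⟨hs, hsk⟩
    rw [min_eq_left ht, max_eq_right ht] at hs
    have hc : ContinuousAt (fun s => a - s * k) s := by fun_prop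
    rcases lt_trichotomy (a - s * k) 0 with h | h | h
    · have hev : (fun s => -(Real.exp (-(l * s)) * expTail ζ B M (a - s * k))) =ᶠ[nhds s]
          fun s => -(Real.exp (-(l * s)) * M) := by
        filter_upwards [hc.eventually (gt_mem_nhds h)] with r hr
        simp [expTail, hr.le]
      refine HasDerivAt.congr_of_eventuallyEq ?_ hev
      rw [expTail, if_pos h.le]
      convert! ((hexp s).mul_const M).neg using 1
      ring
    · refine absurd ?_ hsk
      have hk0 : k ≠ 0 := by rintro rfl; simp at h; linarith
      rw [Set.mem_singleton_iff, eq_div_iff hk0]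
      linarith
    · have hev : (fun s => -(Real.exp (-(l * s)) * expTail ζ B M (a - s * k))) =ᶠ[nhds s]
          fun s => -(Real.exp (-(l * s)) * (B * Real.exp (ζ * (a - s * k)))) := by
        filter_upwards [hc.eventually (lt_mem_nhds h)] with r hr
        simp [expTail, not_le.2 hr]
      refine HasDerivAt.congr_of_eventuallyEq ?_ hev
      rw [expTail, if_neg (not_le.2 h)]
      have h2 : HasDerivAt (fun s => B * Real.exp (ζ * (a - s * k)))
          (B * (Real.exp (ζ * (a - s * k)) * (ζ * -k))) s := by
        have := (((((hasDerivAt_id s).mul_const k).const_sub a).const_mul ζ).exp).const_mul B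
        simpa using this
      convert! ((hexp s).mul h2).neg using 1
      linear_combination (-Real.exp (-(l * s)) * Real.exp (ζ * (a - s * k))) * hbal
  have hint := (intervalIntegrable_iff_integrableOn_Icc_of_le ht).2
    (integrableOn_expTail (M := M) (k := k) (a := a) (t := t) hζ hB' hM hl)
  rw [integral_eq_of_hasDerivAt_off_countable _ _ (Set.countable_singleton (a / k)) hcont hder hint]
  simp
  ring

/-- The measure `μ` on `ℝ₊` has total mass `M` and tail `B e^{ζ y}` on `(0, ∞)`. -/
structure HasExpTail (μ : Measure ℝ≥0) (ζ B M : ℝ) : Prop where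
  tail : ∀ a : ℝ≥0, 0 < a → μ (Set.Ici a) = ENNReal.ofReal (B * Real.exp (ζ * a))
  mass : μ Set.univ = ENNReal.ofReal M

lemma HasExpTail.isFiniteMeasure {μ : Measure ℝ≥0} {ζ B M : ℝ} (h : HasExpTail μ ζ B M) :
    IsFiniteMeasure μ := ⟨by rw [h.mass]; exact ENNReal.ofReal_lt_top⟩

/-- For `a > 0` the truncation at 0 does not affect the event, which is therefore a tail event of
`μ` itself. -/
lemma HasExpTail.measure_preimage {μ : Measure ℝ≥0} {ζ B M : ℝ} (h : HasExpTail μ ζ B M)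
    {a : ℝ≥0} (ha : 0 < a) (y : ℝ) :
    μ {x | a ≤ Real.toNNReal (x + y)} = ENNReal.ofReal (expTail ζ B M (a - y)) := by
  have hset : ∀ x : ℝ≥0, a ≤ Real.toNNReal (x + y) ↔ (a : ℝ) - y ≤ x := fun x => by
    rw [Real.le_toNNReal_iff_coe_le' ha, sub_le_iff_le_add]
  simp only [hset, expTail]
  split_ifs with hy
  · rw [← h.mass]
    congr 1
    ext x
    simpa using hy.trans x.2
  · exact h.tail ⟨a - y, (not_le.1 hy).le⟩ (not_le.1 hy)

lemma HasExpTail.add {μ ν : Measure ℝ≥0} {ζ B M B' M' : ℝ} (h : HasExpTail μ ζ B M)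
    (h' : HasExpTail ν ζ B' M') (hB : 0 ≤ B) (hM : 0 ≤ M) (hB' : 0 ≤ B') (hM' : 0 ≤ M') :
    HasExpTail (μ + ν) ζ (B + B') (M + M') where
  tail a ha := by
    rw [Measure.add_apply, h.tail a ha, h'.tail a ha, ← ENNReal.ofReal_add (by positivity)
      (by positivity), add_mul]
  mass := by rw [Measure.add_apply, h.mass, h'.mass, ENNReal.ofReal_add hM hM']

lemma HasExpTail.smul {μ : Measure ℝ≥0} {ζ B M r : ℝ} (h : HasExpTail μ ζ B M) (hr : 0 ≤ r) :
    HasExpTail (ENNReal.ofReal r • μ) ζ (r * B) (r * M) where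
  tail a ha := by
    rw [Measure.smul_apply, h.tail a ha, smul_eq_mul, ← ENNReal.ofReal_mul hr, mul_assoc]
  mass := by rw [Measure.smul_apply, h.mass, smul_eq_mul, ENNReal.ofReal_mul hr]

/-- Both sides are integrals of `g`, the right one against the measure `ν` below, and a finite
measure on the half-line is determined by its values on `Set.Ici a`. For `a = 0` this is the balance
of the masses, which holds because `μ` and `β` both have mass `M`; for `a > 0` it is
`integral_expTail`. -/
lemma HasExpTail.lintegral_balance {μ β : Measure ℝ≥0} {ζ B B' M k t : ℝ} (hω : 0 < ω)
    (hμ : HasExpTail μ ζ B M) (hβ : HasExpTail β ζ B' M) (hζ : ζ ≤ 0) (hB : 0 ≤ B)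
    (hB' : 0 ≤ B') (hM : 0 ≤ M) (ht : 0 ≤ t) (hbal : (2 * ω + ζ * k) * B = 2 * ω * B')
    (hk : 0 < k → B = M) {g : ℝ≥0 → ℝ≥0∞} (hg : Measurable g) :
    ∫⁻ x, g x ∂μ = survival ω t * ∫⁻ x, g (Real.toNNReal (x + t * k)) ∂μ +
      ∫⁻ s in Set.Icc 0 t, ENNReal.ofReal (2 * ω) * survival ω s *
        ∫⁻ x, g (Real.toNNReal (x + s * k)) ∂β := by
  have := hμ.isFiniteMeasure
  have := hβ.isFiniteMeasure
  have hψ : Measurable fun q : ℝ × ℝ≥0 => Real.toNNReal (q.2 + q.1 * k) := by fun_prop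
  have hsv := measurable_survival ω
  let ρ : Measure ℝ := (volume.restrict (Set.Icc 0 t)).withDensity
    fun s => ENNReal.ofReal (2 * ω) * survival ω s
  have hρ : ∀ {F : ℝ → ℝ≥0∞}, Measurable F → ∫⁻ s, F s ∂ρ =
      ∫⁻ s in Set.Icc 0 t, ENNReal.ofReal (2 * ω) * survival ω s * F s := fun hF =>
    lintegral_withDensity_eq_lintegral_mul _ (by fun_prop) hF
  have hμψ : Measurable fun x : ℝ≥0 => Real.toNNReal (x + t * k) := by fun_prop
  let ν : Measure ℝ≥0 := survival ω t • μ.map (fun x : ℝ≥0 => Real.toNNReal (x + t * k)) +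
    (ρ.prod β).map fun q : ℝ × ℝ≥0 => Real.toNNReal (q.2 + q.1 * k)
  have hν : ∀ {g : ℝ≥0 → ℝ≥0∞}, Measurable g → ∫⁻ x, g x ∂ν =
      survival ω t * ∫⁻ x, g (Real.toNNReal (x + t * k)) ∂μ +
      ∫⁻ s in Set.Icc 0 t, ENNReal.ofReal (2 * ω) * survival ω s *
        ∫⁻ x, g (Real.toNNReal (x + s * k)) ∂β := by
    intro g hg
    rw [lintegral_add_measure, lintegral_smul_measure, lintegral_map hg hμψ, lintegral_map hg hψ,
      lintegral_prod (fun q : ℝ × ℝ≥0 => g (Real.toNNReal (q.2 + q.1 * k)))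
        (hg.comp hψ).aemeasurable, hρ]
    · rfl
    · exact (hg.comp hψ).lintegral_prod_right'
  have hind : ∀ (a : ℝ≥0) (κ : Measure ℝ≥0) (y : ℝ),
      ∫⁻ x, (Set.Ici a).indicator 1 (Real.toNNReal (x + y)) ∂κ =
        κ {x | a ≤ Real.toNNReal (x + y)} := by
    intro a κ y
    have hm : Measurable fun x : ℝ≥0 => Real.toNNReal (x + y) := by fun_prop
    exact lintegral_indicator_one (hm measurableSet_Ici)
  rw [← hν hg]
  congr 1
  refine Measure.ext_of_Ici _ _ fun a => ?_
  rw [← lintegral_indicator_one (μ := ν) measurableSet_Ici,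
    hν (measurable_one.indicator measurableSet_Ici)]
  simp only [hind]
  rcases eq_or_lt_of_le (zero_le (a := a)) with rfl | ha
  · have huniv : ∀ y : ℝ, {x : ℝ≥0 | 0 ≤ Real.toNNReal (x + y)} = Set.univ := by simp
    have hIci : Set.Ici (0 : ℝ≥0) = Set.univ := Set.Ici_bot
    simp only [huniv, hIci, hμ.mass, hβ.mass]
    rw [lintegral_mul_const _ (by fun_prop), setLIntegral_survival hω ht, ← add_mul,
      add_tsub_cancel_of_le (survival_le_one hω ht), one_mul]
  · simp only [hμ.measure_preimage ha, hβ.measure_preimage ha]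
    have hreal := integral_expTail (a := a) hζ hB' hM (by positivity) ha ht hbal hk
    have hnn : ∀ s, 0 ≤ 2 * ω * Real.exp (-(2 * ω * s)) * expTail ζ B' M (a - s * k) := fun s =>
      mul_nonneg (by positivity) (expTail_nonneg hB' hM _)
    have hint := integrableOn_expTail (k := k) (a := a) (t := t) hζ hB' hM
      (show 0 ≤ 2 * ω by positivity)
    have h : ∫⁻ s in Set.Icc 0 t, ENNReal.ofReal (2 * ω) * survival ω s *
        ENNReal.ofReal (expTail ζ B' M (a - s * k)) = ENNReal.ofReal
          (expTail ζ B M a - Real.exp (-(2 * ω * t)) * expTail ζ B M (a - t * k)) := by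
      rw [← hreal, intervalIntegral.integral_of_le ht, ← integral_Icc_eq_integral_Ioc,
        ofReal_integral_eq_lintegral_ofReal hint (Filter.Eventually.of_forall hnn)]
      refine lintegral_congr fun s => ?_
      rw [survival, ← ENNReal.ofReal_mul (by positivity), ← ENNReal.ofReal_mul (by positivity)]
    rw [h, survival, ← ENNReal.ofReal_mul (by positivity), ← ENNReal.ofReal_add]
    · rw [add_sub_cancel, hμ.tail a ha, expTail, if_neg (not_le.2 (by exact ha))]
    · exact mul_nonneg (Real.exp_nonneg _) (expTail_nonneg hB hM _)
    · rw [← hreal]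
      exact intervalIntegral.integral_nonneg ht fun s _ => hnn s

lemma lintegral_lebesgueHalfLine {F : ℝ≥0 → ℝ≥0∞} (hF : Measurable F) :
    ∫⁻ x, F x ∂lebesgueHalfLine = ∫⁻ y in Set.Ici (0 : ℝ), F (Real.toNNReal y) :=
  lintegral_map hF measurable_real_toNNReal

lemma lintegral_exp_mul_Ioi {A ζ : ℝ} (hA : 0 ≤ A) (hζ : ζ < 0) (a : ℝ) :
    ∫⁻ y in Set.Ioi a, ENNReal.ofReal (A * Real.exp (ζ * y)) =
      ENNReal.ofReal (A / -ζ * Real.exp (ζ * a)) := by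
  rw [← ofReal_integral_eq_lintegral_ofReal ((integrableOn_exp_mul_Ioi hζ a).const_mul A)
    (Filter.Eventually.of_forall fun y => mul_nonneg hA (Real.exp_nonneg _)),
    integral_const_mul, integral_exp_mul_Ioi hζ]
  congr 1
  have := hζ.ne
  field_simp

lemma hasExpTail_withDensity {A ζ : ℝ} (hA : 0 ≤ A) (hζ : ζ < 0) :
    HasExpTail (lebesgueHalfLine.withDensity fun x => ENNReal.ofReal (A * Real.exp (ζ * x))) ζ
      (A / -ζ) (A / -ζ) := by
  have hm : Measurable fun x : ℝ≥0 => ENNReal.ofReal (A * Real.exp (ζ * x)) := by fun_prop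
  have key : ∀ a : ℝ≥0, (lebesgueHalfLine.withDensity
      fun x => ENNReal.ofReal (A * Real.exp (ζ * x))) (Set.Ici a) =
        ENNReal.ofReal (A / -ζ * Real.exp (ζ * a)) := by
    intro a
    rw [withDensity_apply _ measurableSet_Ici, ← lintegral_indicator measurableSet_Ici,
      lintegral_lebesgueHalfLine (hm.indicator measurableSet_Ici),
      ← lintegral_exp_mul_Ioi hA hζ, ← setLIntegral_congr (Ioi_ae_eq_Ici (a := (a : ℝ))).symm,
      ← lintegral_indicator measurableSet_Ici, ← lintegral_indicator measurableSet_Ici]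
    refine lintegral_congr fun y => ?_
    simp only [Set.indicator, Set.mem_Ici]
    by_cases hy : 0 ≤ y
    · simp [hy, Real.le_toNNReal_iff_coe_le hy]
    · have hay : ¬(a : ℝ) ≤ y := fun h => hy (a.2.trans h)
      rw [if_neg hy, if_neg hay]
  refine ⟨fun a _ => key a, ?_⟩
  have h := key 0
  rwa [show Set.Ici (0 : ℝ≥0) = Set.univ from Set.Ici_bot, NNReal.coe_zero, mul_zero,
    Real.exp_zero, mul_one] at h

lemma hasExpTail_dirac (ζ : ℝ) : HasExpTail (Measure.dirac 0) ζ 0 1 where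
  tail a ha := by simp [ha.ne']
  mass := by simp

/-! ### Weights and balance of the explicit measure -/

/-- The restriction of `explicitMeasure` to a velocity. -/
def marginal (ω c v : ℝ) (σ : RelVel) : Measure ℝ≥0 :=
  ENNReal.ofReal (diracWeight c v σ) • Measure.dirac (0 : ℝ≥0) +
    lebesgueHalfLine.withDensity
      fun x => ENNReal.ofReal (densityWeight ω c v σ * Real.exp (zeta ω c v * x))

lemma zeta_neg (hω : 0 < ω) (hc : 0 < c) (hcv : c < v) : zeta ω c v < 0 := by
  have : 0 < v ^ 2 - c ^ 2 := by nlinarith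
  unfold zeta
  exact div_neg_of_neg_of_pos (by simp; positivity) this

/-- The mass of a velocity away from `0` under `explicitMeasure`. -/
def tailWeight (c v : ℝ) : RelVel → ℝ
  | .pos2 => 1 / 4
  | .zero => (v - c) / (2 * (v + c))
  | .neg2 => (v - c) ^ 2 / (4 * (v + c) ^ 2)

/-- The mass of a velocity under `explicitMeasure`. -/
def velocityWeight : RelVel → ℝ
  | .pos2 => 1 / 4
  | .zero => 1 / 2
  | .neg2 => 1 / 4

lemma tailWeight_nonneg (hc : 0 < c) (hcv : c < v) (σ : RelVel) : 0 ≤ tailWeight c v σ := by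
  have : 0 < v - c := sub_pos.2 hcv
  have : 0 < v := hc.trans hcv
  cases σ <;> simp only [tailWeight] <;> positivity

lemma velocityWeight_nonneg (σ : RelVel) : 0 ≤ velocityWeight σ := by
  cases σ <;> norm_num [velocityWeight]

lemma diracWeight_nonneg (hc : 0 < c) (hcv : c < v) (σ : RelVel) : 0 ≤ diracWeight c v σ := by
  have : 0 < v := hc.trans hcv
  cases σ <;> simp only [diracWeight] <;> positivity

lemma densityWeight_nonneg (hω : 0 < ω) (hc : 0 < c) (hcv : c < v) (σ : RelVel) :
    0 ≤ densityWeight ω c v σ := by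
  have : 0 < v - c := sub_pos.2 hcv
  have : 0 < v := hc.trans hcv
  have : 0 < v ^ 2 - c ^ 2 := by nlinarith
  cases σ <;> simp only [densityWeight] <;> positivity

lemma densityWeight_div_zeta (hω : 0 < ω) (hc : 0 < c) (hcv : c < v) (σ : RelVel) :
    densityWeight ω c v σ / -zeta ω c v = tailWeight c v σ := by
  have h1 : v - c ≠ 0 := (sub_pos.2 hcv).ne'
  have h2 : v + c ≠ 0 := by linarith
  have h3 : c + v ≠ 0 := by linarith
  have h4 : v ^ 2 - c ^ 2 = (v - c) * (v + c) := by ring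
  cases σ <;> simp only [densityWeight, zeta, tailWeight, h4] <;> field_simp <;> ring

lemma diracWeight_add_tailWeight (hc : 0 < c) (hcv : c < v) (σ : RelVel) :
    diracWeight c v σ + tailWeight c v σ = velocityWeight σ := by
  have h2 : v + c ≠ 0 := by linarith
  have h3 : c + v ≠ 0 := by linarith
  cases σ <;> simp only [diracWeight, tailWeight, velocityWeight] <;> field_simp <;> ring

/-- The atom at 0 contributes to the mass but not to the tail on positive half-lines. -/
lemma hasExpTail_marginal (hω : 0 < ω) (hc : 0 < c) (hcv : c < v) (σ : RelVel) :
    HasExpTail (marginal ω c v σ) (zeta ω c v) (tailWeight c v σ) (velocityWeight σ) := by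
  have hd := diracWeight_nonneg hc hcv σ
  have ht := tailWeight_nonneg hc hcv σ
  have h := ((hasExpTail_dirac (zeta ω c v)).smul hd).add
    (hasExpTail_withDensity (densityWeight_nonneg hω hc hcv σ) (zeta_neg hω hc hcv))
    (by simp) (by simpa using hd) (by rwa [densityWeight_div_zeta hω hc hcv])
    (by rwa [densityWeight_div_zeta hω hc hcv])
  rwa [densityWeight_div_zeta hω hc hcv, mul_zero, zero_add, mul_one,
    diracWeight_add_tailWeight hc hcv] at h

lemma sum_relVel {M : Type*} [AddCommMonoid M] (F : RelVel → M) :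
    ∑ σ, F σ = F .pos2 + (F .zero + F .neg2) := by
  change ∑ σ ∈ {.pos2, .zero, .neg2}, F σ = _
  rw [Finset.sum_insert (by simp), Finset.sum_insert (by simp), Finset.sum_singleton]

lemma lintegral_explicitMeasure (hω : 0 < ω) (hc : 0 < c) (hcv : c < v) {f : State → ℝ≥0∞}
    (hf : Measurable f) :
    ∫⁻ z, f z ∂explicitMeasure ω c v = ∑ σ, ∫⁻ x, f (x, σ) ∂marginal ω c v σ := by
  have := fun σ => (hasExpTail_marginal hω hc hcv σ).isFiniteMeasure
  change ∫⁻ z, f z ∂(∑ σ, (marginal ω c v σ).prod (Measure.dirac σ)) = _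
  rw [lintegral_finsetSum_measure]
  refine Finset.sum_congr rfl fun σ _ => ?_
  rw [lintegral_prod _ hf.aemeasurable]
  simp

lemma isProbabilityMeasure_explicitMeasure (hω : 0 < ω) (hc : 0 < c) (hcv : c < v) :
    IsProbabilityMeasure (explicitMeasure ω c v) := by
  refine ⟨?_⟩
  rw [← lintegral_one, lintegral_explicitMeasure hω hc hcv measurable_const, sum_relVel]
  simp only [lintegral_one, (hasExpTail_marginal hω hc hcv _).mass, velocityWeight]
  rw [← ENNReal.ofReal_add (by norm_num) (by norm_num),
    ← ENNReal.ofReal_add (by norm_num) (by norm_num)]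
  norm_num

/-- The measure of the positions from which the jumps arrive at a velocity. -/
def incoming (ω c v : ℝ) : RelVel → Measure ℝ≥0
  | .pos2 => ENNReal.ofReal (1 / 2) • marginal ω c v .zero
  | .zero => marginal ω c v .pos2 + marginal ω c v .neg2
  | .neg2 => ENNReal.ofReal (1 / 2) • marginal ω c v .zero

lemma lintegral_jumpLaw (hω : 0 < ω) (σ : RelVel) (F : RelVel → ℝ≥0∞) :
    ∫⁻ τ, F τ ∂jumpLaw ω σ = match σ with
      | .pos2 => F .zero
      | .zero => ENNReal.ofReal (1 / 2) * F .pos2 + ENNReal.ofReal (1 / 2) * F .neg2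
      | .neg2 => F .zero := by
  have h1 : 2 * ω / (2 * ω) = 1 := div_self (by positivity)
  have h2 : ω / (2 * ω) = 1 / 2 := by field_simp
  rw [jumpLaw, lintegral_finsetSum_measure, sum_relVel]
  cases σ <;> simp [exitRate_eq, rateMatrix, h1, h2]

/-- Duality: `incoming` is the image of the explicit measure under the jump of the velocity. -/
lemma lintegral_jumpOp_explicitMeasure (hω : 0 < ω) (hc : 0 < c) (hcv : c < v)
    {f : State → ℝ≥0∞} (hf : Measurable f) :
    ∫⁻ z, jumpOp ω f z ∂explicitMeasure ω c v = ∑ σ, ∫⁻ x, f (x, σ) ∂incoming ω c v σ := by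
  have hfσ : ∀ σ, Measurable fun x => f (x, σ) := fun σ => hf.comp measurable_prodMk_right
  have hm : Measurable (jumpOp ω f) := measurable_jumpOp hω (F := fun _ : State => f)
    (hf.comp measurable_snd) measurable_id
  rw [lintegral_explicitMeasure hω hc hcv hm, sum_relVel, sum_relVel]
  simp only [jumpOp, lintegral_jumpLaw hω, incoming, lintegral_smul_measure, smul_eq_mul,
    lintegral_add_measure]
  rw [lintegral_add_left ((hfσ _).const_mul _), lintegral_const_mul _ (hfσ _),
    lintegral_const_mul _ (hfσ _)]
  ring

/-- The tail weights of the incoming measures. -/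
def incomingWeight (c v : ℝ) : RelVel → ℝ
  | .pos2 => 1 / 2 * tailWeight c v .zero
  | .zero => tailWeight c v .pos2 + tailWeight c v .neg2
  | .neg2 => 1 / 2 * tailWeight c v .zero

lemma incomingWeight_nonneg (hc : 0 < c) (hcv : c < v) (σ : RelVel) :
    0 ≤ incomingWeight c v σ := by
  have := tailWeight_nonneg hc hcv
  cases σ
  · exact mul_nonneg (by norm_num) (this _)
  · exact add_nonneg (this _) (this _)
  · exact mul_nonneg (by norm_num) (this _)

/-- The masses are unchanged because (1/4, 1/2, 1/4) is stationary for the jump chain; only the tail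
weights change. -/
lemma hasExpTail_incoming (hω : 0 < ω) (hc : 0 < c) (hcv : c < v) (σ : RelVel) :
    HasExpTail (incoming ω c v σ) (zeta ω c v) (incomingWeight c v σ) (velocityWeight σ) := by
  have h := hasExpTail_marginal hω hc hcv
  have ht := tailWeight_nonneg hc hcv
  have hhalf := (h .zero).smul (r := 1 / 2) (by norm_num)
  have hsum := (h .pos2).add (h .neg2) (ht _) (velocityWeight_nonneg _) (ht _)
    (velocityWeight_nonneg _)
  cases σ
  · convert! hhalf using 1
    norm_num [velocityWeight]
  · convert! hsum using 1
    norm_num [velocityWeight]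
  · convert! hhalf using 1
    norm_num [velocityWeight]

/-- The stationarity equation away from 0, where transport at speed `-2 * c + v * σ.val` turns
`e^{ζy}` into a multiple of itself. The value of `ζ` makes these three equations compatible. -/
lemma balance_weights (hω : 0 < ω) (hc : 0 < c) (hcv : c < v) (σ : RelVel) :
    (2 * ω + zeta ω c v * (-2 * c + v * σ.val)) * tailWeight c v σ =
      2 * ω * incomingWeight c v σ := by
  have h1 : v - c ≠ 0 := (sub_pos.2 hcv).ne'
  have h2 : v + c ≠ 0 := by linarith
  have h4 : v ^ 2 - c ^ 2 = (v - c) * (v + c) := by ring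
  cases σ <;> simp only [zeta, tailWeight, incomingWeight, RelVel.val, h4] <;> field_simp <;> ring

/-- Stationarity of `explicitMeasure`, in the integrated form along the clamped flow. -/
lemma lintegral_explicitMeasure_balance (hω : 0 < ω) (hc : 0 < c) (hcv : c < v) {t : ℝ}
    (ht : 0 ≤ t) {f : State → ℝ≥0∞} (hf : Measurable f) :
    ∫⁻ z, f z ∂explicitMeasure ω c v =
      survival ω t * ∫⁻ z, f (clampedFlow c v t z) ∂explicitMeasure ω c v +
      ∫⁻ s in Set.Icc 0 t, ENNReal.ofReal (2 * ω) * survival ω s *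
        ∫⁻ z, jumpOp ω (fun y => f (clampedFlow c v s y)) z ∂explicitMeasure ω c v := by
  have hΦ : ∀ s, Measurable fun z => f (clampedFlow c v s z) := fun s =>
    hf.comp ((measurable_clampedFlow c v).comp measurable_prodMk_left)
  have hsv := measurable_survival ω
  have hσ : ∀ σ, ∫⁻ x, f (x, σ) ∂marginal ω c v σ =
      survival ω t * ∫⁻ x, f (clampedFlow c v t (x, σ)) ∂marginal ω c v σ +
      ∫⁻ s in Set.Icc 0 t, ENNReal.ofReal (2 * ω) * survival ω s *
        ∫⁻ x, f (clampedFlow c v s (x, σ)) ∂incoming ω c v σ := fun σ =>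
    (hasExpTail_marginal hω hc hcv σ).lintegral_balance hω (hasExpTail_incoming hω hc hcv σ)
      (zeta_neg hω hc hcv).le (tailWeight_nonneg hc hcv σ) (incomingWeight_nonneg hc hcv σ)
      (velocityWeight_nonneg σ) ht (balance_weights hω hc hcv σ)
      -- Only velocity 2 moves upwards, and there both weights are 1/4; this is where the vanishing
      -- of the atom `d_2` enters.
      (fun hk => by cases σ <;> simp [RelVel.val] at hk ⊢ <;> first | rfl | nlinarith)
      (hf.comp measurable_prodMk_right)
  have hm : ∀ σ, Measurable fun s => ENNReal.ofReal (2 * ω) * survival ω s *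
      ∫⁻ x, f (clampedFlow c v s (x, σ)) ∂incoming ω c v σ := fun σ => by
    have := (hasExpTail_incoming hω hc hcv σ).isFiniteMeasure
    refine Measurable.mul (by fun_prop) (Measurable.lintegral_prod_right ?_)
    exact (hf.comp (measurable_clampedFlow c v)).comp
      (f := fun q : ℝ × ℝ≥0 => (q.1, (q.2, σ))) (by fun_prop)
  rw [lintegral_explicitMeasure hω hc hcv hf, lintegral_explicitMeasure hω hc hcv (hΦ t)]
  simp only [lintegral_jumpOp_explicitMeasure hω hc hcv (hΦ _), Finset.mul_sum]
  rw [lintegral_finsetSum _ fun σ _ => hm σ, ← Finset.sum_add_distrib]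
  exact Finset.sum_congr rfl fun σ _ => hσ σ

/-! ### Invariance of the explicit measure -/

lemma setLIntegral_Icc_comp_sub (t : ℝ) (F : ℝ → ℝ≥0∞) :
    ∫⁻ s in Set.Icc 0 t, F (t - s) = ∫⁻ s in Set.Icc 0 t, F s := by
  rw [← lintegral_indicator measurableSet_Icc, ← lintegral_indicator measurableSet_Icc,
    ← lintegral_sub_left_eq_self _ t]
  refine lintegral_congr fun s => ?_
  have h : t - s ∈ Set.Icc 0 t ↔ s ∈ Set.Icc 0 t := by
    simp only [Set.mem_Icc]
    constructor <;> rintro ⟨h1, h2⟩ <;> constructor <;> linarith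
  by_cases hs : s ∈ Set.Icc 0 t
  · rw [Set.indicator_of_mem hs, Set.indicator_of_mem (h.2 hs), sub_sub_cancel]
  · rw [Set.indicator_of_notMem hs, Set.indicator_of_notMem (mt h.1 hs)]

/-- The measurable functions on `State` with values in `[0, 1]`. -/
def UnitTest : Type := {f : State → ℝ≥0∞ // Measurable f ∧ ∀ z, f z ≤ 1}

/-- The integral of `P_t f` and the integral of `f` against the explicit measure solve the same
last-jump equation, by `hlast` and `hbal`. The equation replaces `f` by `G f (t - s)`, so the
contraction runs over all functions in `UnitTest` at once, and it is applied in both directions. -/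
lemma lintegral_lintegral_transition_explicitMeasure (hω : 0 < ω) (hc : 0 < c) (hcv : c < v)
    {t : ℝ} (ht : 0 ≤ t) {f : State → ℝ≥0∞} (hf : Measurable f) (hf1 : ∀ z, f z ≤ 1) :
    ∫⁻ z, ∫⁻ y, f y ∂transition ω c v hω t z ∂explicitMeasure ω c v =
      ∫⁻ z, f z ∂explicitMeasure ω c v := by
  have hprob := isProbabilityMeasure_explicitMeasure hω hc hcv
  have hmk := isMarkovKernel_transition (c := c) (v := v) hω
  have hsv := measurable_survival ω
  have hΦ := measurable_clampedFlow c v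
  set π := explicitMeasure ω c v
  set lam := ENNReal.ofReal (2 * ω)
  let G : (State → ℝ≥0∞) → ℝ → State → ℝ≥0∞ := fun f r y =>
    jumpOp ω (fun x => f (clampedFlow c v r x)) y
  have hG : ∀ {f}, Measurable f → Measurable (Function.uncurry (G f)) := fun {f} hf =>
    measurable_jumpOp hω (F := fun (q : ℝ × State) x => f (clampedFlow c v q.1 x))
      (hf.comp (hΦ.comp (f := fun q : (ℝ × State) × State => (q.1.1, q.2)) (by fun_prop)))
      measurable_snd
  have hGr : ∀ {f}, Measurable f → ∀ r, Measurable (G f r) := fun hf r =>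
    (hG hf).comp measurable_prodMk_left
  have hG1 : ∀ {f : State → ℝ≥0∞}, (∀ z, f z ≤ 1) → ∀ r y, G f r y ≤ 1 := fun hf1 r y =>
    (jumpOp_mono (fun _ => hf1 _) y).trans (jumpOp_const hω 1 y).le
  have hlast : ∀ t, 0 ≤ t → ∀ {f : State → ℝ≥0∞}, Measurable f → (∀ z, f z ≤ 1) →
      ∫⁻ z, ∫⁻ y, f y ∂transition ω c v hω t z ∂π =
        survival ω t * ∫⁻ z, f (clampedFlow c v t z) ∂π +
        ∫⁻ s in Set.Icc 0 t, lam * survival ω (t - s) *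
          ∫⁻ z, ∫⁻ y, G f (t - s) y ∂transition ω c v hω s z ∂π := by
    intro t ht f hf hf1
    have hΦt : Measurable fun z => f (clampedFlow c v t z) :=
      hf.comp (hΦ.comp measurable_prodMk_left)
    have hPG : Measurable fun q : State × ℝ =>
        lam * survival ω (t - q.2) * ∫⁻ y, G f (t - q.2) y ∂transition ω c v hω q.2 q.1 := by
      refine Measurable.mul (by fun_prop) ?_
      exact measurable_lintegral_transition hω (α := State × ℝ) (F := fun q => G f (t - q.2))
        ((hG hf).comp (f := fun q : (State × ℝ) × State => (t - q.1.2, q.2)) (by fun_prop))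
        (by fun_prop) (by fun_prop)
    simp_rw [fun z => lintegral_transition_eq_last_jump (c := c) (v := v) hω ht hf hf1 z]
    rw [lintegral_add_left (hΦt.const_mul _), lintegral_const_mul _ hΦt,
      lintegral_lintegral_swap hPG.aemeasurable]
    congr 1
    refine lintegral_congr fun s => ?_
    refine lintegral_const_mul _ (measurable_lintegral_transition hω (F := fun _ => G f (t - s))
      ((hGr hf _).comp measurable_snd) measurable_const measurable_id)
  have hbal : ∀ t, 0 ≤ t → ∀ {f : State → ℝ≥0∞}, Measurable f →
      ∫⁻ z, f z ∂π = survival ω t * ∫⁻ z, f (clampedFlow c v t z) ∂π +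
        ∫⁻ s in Set.Icc 0 t, lam * survival ω (t - s) * ∫⁻ z, G f (t - s) z ∂π := by
    intro t ht f hf
    rw [setLIntegral_Icc_comp_sub t fun s => lam * survival ω s * ∫⁻ z, G f s z ∂π]
    exact lintegral_explicitMeasure_balance hω hc hcv ht hf
  have hk : ∀ r, Measurable fun s => lam * survival ω (r - s) := fun r => by fun_prop
  have hkint : ∀ r, 0 ≤ r → ∫⁻ s in Set.Icc 0 r, lam * survival ω (r - s) = 1 - survival ω r :=
    fun r hr => by
      rw [setLIntegral_Icc_comp_sub r fun s => lam * survival ω s, setLIntegral_survival hω hr]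
  have hstep : ∀ {a b : (State → ℝ≥0∞) → ℝ → ℝ≥0∞} {M : ℝ≥0∞} {r : ℝ} {f : State → ℝ≥0∞},
      r ∈ Set.Icc 0 t → (∀ s ∈ Set.Icc 0 t, a (G f (r - s)) s ≤ b (G f (r - s)) s + M) →
      ∀ A, A + ∫⁻ s in Set.Icc 0 r, lam * survival ω (r - s) * a (G f (r - s)) s ≤
        (A + ∫⁻ s in Set.Icc 0 r, lam * survival ω (r - s) * b (G f (r - s)) s) +
          (1 - survival ω t) * M := by
    intro a b M r f hr hab A
    rw [add_assoc]
    refine add_le_add_right ?_ _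
    calc _ ≤ ∫⁻ s in Set.Icc 0 r, (lam * survival ω (r - s) * b (G f (r - s)) s +
              lam * survival ω (r - s) * M) := by
          refine setLIntegral_mono' measurableSet_Icc fun s hs => ?_
          rw [← mul_add]
          exact mul_le_mul_right (hab s ⟨hs.1, hs.2.trans hr.2⟩) _
      _ = _ + (1 - survival ω r) * M := by
          rw [lintegral_add_right _ ((hk r).mul_const M), lintegral_mul_const _ (hk r),
            hkint r hr.1]
      _ ≤ _ := add_le_add_right (mul_le_mul_left (one_sub_survival_mono hω hr.2) _) _
  have hP1 : ∀ {f : State → ℝ≥0∞}, (∀ z, f z ≤ 1) → ∀ s,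
      ∫⁻ z, ∫⁻ y, f y ∂transition ω c v hω s z ∂π ≤ 1 := fun hf1 s =>
    (lintegral_mono fun z => lintegral_mono hf1).trans (by simp)
  have hπ1 : ∀ {f : State → ℝ≥0∞}, (∀ z, f z ≤ 1) → ∫⁻ z, f z ∂π ≤ 1 := fun hf1 =>
    (lintegral_mono hf1).trans (by simp)
  let i : Set.Icc 0 t × UnitTest := (⟨t, ht, le_rfl⟩, ⟨f, hf, hf1⟩)
  refine le_antisymm ?_ ?_
  · refine le_of_contraction (ι := Set.Icc 0 t × UnitTest)
      (u := fun i => ∫⁻ z, ∫⁻ y, i.2.1 y ∂transition ω c v hω i.1 z ∂π)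
      (w := fun i => ∫⁻ z, i.2.1 z ∂π) (one_sub_survival_lt_one ω t) ENNReal.one_ne_top
      (fun i => (hP1 i.2.2.2 _).trans le_add_self) ?_ i
    rintro M hM ⟨⟨r, hr⟩, ⟨g, hg, hg1⟩⟩
    simp only
    rw [hlast r hr.1 hg hg1, hbal r hr.1 hg]
    exact hstep (a := fun g s => ∫⁻ z, ∫⁻ y, g y ∂transition ω c v hω s z ∂π)
      (b := fun g _ => ∫⁻ z, g z ∂π) hr
      (fun s hs => hM (⟨s, hs⟩, ⟨G g (r - s), hGr hg _, hG1 hg1 _⟩)) _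
  · refine le_of_contraction (ι := Set.Icc 0 t × UnitTest)
      (u := fun i => ∫⁻ z, i.2.1 z ∂π)
      (w := fun i => ∫⁻ z, ∫⁻ y, i.2.1 y ∂transition ω c v hω i.1 z ∂π)
      (one_sub_survival_lt_one ω t) ENNReal.one_ne_top
      (fun i => (hπ1 i.2.2.2).trans le_add_self) ?_ i
    rintro M hM ⟨⟨r, hr⟩, ⟨g, hg, hg1⟩⟩
    simp only
    rw [hlast r hr.1 hg hg1, hbal r hr.1 hg]
    exact hstep (b := fun g s => ∫⁻ z, ∫⁻ y, g y ∂transition ω c v hω s z ∂π)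
      (a := fun g _ => ∫⁻ z, g z ∂π) hr
      (fun s hs => hM (⟨s, hs⟩, ⟨G g (r - s), hGr hg _, hG1 hg1 _⟩)) _

lemma isInvariantProbability_explicitMeasure (hω : 0 < ω) (hc : 0 < c) (hcv : c < v) :
    IsInvariantProbability ω c v hω (explicitMeasure ω c v) := by
  refine ⟨isProbabilityMeasure_explicitMeasure hω hc hcv, fun t ht => Measure.ext fun s hs => ?_⟩
  have h := lintegral_lintegral_transition_explicitMeasure hω hc hcv ht
    (f := s.indicator 1) (measurable_one.indicator hs)
    (Set.indicator_le_self' (fun _ _ => zero_le))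
  simp only [lintegral_indicator_one hs] at h
  rwa [Measure.bind_apply hs (Kernel.aemeasurable _)]

/-! ### Uniqueness -/

lemma invariant_apply {κ : Kernel State State} {μ : Measure State} (h : κ.Invariant μ)
    {s : Set State} (hs : MeasurableSet s) : ∫⁻ z, κ z s ∂μ = μ s := by
  rw [← Measure.bind_apply hs (Kernel.aemeasurable _), h.def]

/-- The state at the origin with velocity `-2`. -/
def atom : State := (0, .neg2)

/-- A sufficiently early jump from `σ` to `τ` leaves enough time for the path from `τ`. The number
`2 * (c + v)` is the speed of descent at velocity -2, so the hypothesis on `x` says that 0 can be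
reached strictly before `t`. -/
lemma transition_atom_pos_of_jump (hω : 0 < ω) (hc : 0 < c) (hcv : c < v) {σ τ : RelVel}
    (hJ : ∀ F : RelVel → ℝ≥0∞, 0 < F τ → 0 < ∫⁻ ρ, F ρ ∂jumpLaw ω σ)
    (hτ : ∀ (r : ℝ) (y : ℝ≥0), (y : ℝ) < r * (2 * (c + v)) →
      0 < transition ω c v hω r (y, τ) {atom})
    (t : ℝ) (x : ℝ≥0) (hx : (x : ℝ) < t * (2 * (c + v))) :
    0 < transition ω c v hω t (x, σ) {atom} := by
  have hx0 : (0 : ℝ) ≤ x := x.2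
  have hv : 0 < v := hc.trans hcv
  have ht : 0 < t := by
    by_contra h
    nlinarith
  -- Until time `s` the position rises by at most `2 * (v - c) * s`, while the reachable height
  -- drops by `2 * (c + v) * s`. The slack thus shrinks by at most `4 * v * s`, and stays positive
  -- for `s < ε`.
  let ε : ℝ := (t * (2 * (c + v)) - x) / (4 * v)
  have hε : 0 < ε := div_pos (by linarith) (by positivity)
  have hεt : ε ≤ t := by
    rw [div_le_iff₀ (by positivity)]
    nlinarith
  have hm : Measurable fun s => ENNReal.ofReal (2 * ω) * survival ω s *
      jumpOp ω (fun w => transition ω c v hω (t - s) w {atom}) (clampedFlow c v s (x, σ)) := by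
    have hsv := measurable_survival ω
    refine Measurable.mul (by fun_prop) (measurable_jumpOp hω
      (F := fun s w => transition ω c v hω (t - s) w {atom}) ?_
      ((measurable_clampedFlow c v).comp measurable_prodMk_right))
    have := measurable_lintegral_transition (c := c) (v := v) hω (α := ℝ × State)
      (F := fun _ => ({atom} : Set State).indicator 1) (t := fun q => t - q.1) (Z := Prod.snd)
      ((measurable_one.indicator (measurableSet_singleton _)).comp measurable_snd)
      (by fun_prop) measurable_snd
    simp only [lintegral_indicator_one (measurableSet_singleton _)] at this
    exact this
  have hfirst := lintegral_transition_eq_first_jump (c := c) (v := v) hω ht.le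
    (f := ({atom} : Set State).indicator 1)
    (measurable_one.indicator (measurableSet_singleton _)) (x, σ)
  simp only [lintegral_indicator_one (measurableSet_singleton _)] at hfirst
  rw [hfirst]
  refine lt_of_lt_of_le ?_ le_add_self
  refine lt_of_lt_of_le ?_ (lintegral_mono_set (s := Set.Ioo 0 ε)
    fun s hs => ⟨hs.1.le, hs.2.le.trans hεt⟩)
  rw [setLIntegral_pos_iff hm]
  refine lt_of_lt_of_le (b := volume (Set.Ioo 0 ε)) (by simpa using hε) (measure_mono ?_)
  refine Set.subset_inter (fun s hs => ?_) subset_rfl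
  have hs4 : s * (4 * v) < t * (2 * (c + v)) - x := (lt_div_iff₀ (by positivity)).1 hs.2
  have hs0 : 0 < s := hs.1
  refine (ENNReal.mul_pos (mul_ne_zero (by simpa using hω) ?_) ?_).ne'
  · simpa [survival] using Real.exp_pos _
  · refine (hJ _ (hτ _ _ ?_)).ne'
    have hσ : σ.val ≤ 2 := by cases σ <;> norm_num [RelVel.val]
    have h1 : s * (v * σ.val) ≤ s * (v * 2) := by gcongr
    have h2 : 0 ≤ s * (v - c) := mul_nonneg hs0.le (by linarith)
    rw [clampedFlow, Real.coe_toNNReal', max_lt_iff, flow]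
    constructor <;> nlinarith

/-- The state `atom` is reached from all positions with positive probability. -/
lemma transition_atom_pos (hω : 0 < ω) (hc : 0 < c) (hcv : c < v) (σ : RelVel) :
    ∀ (t : ℝ) (x : ℝ≥0), (x : ℝ) < t * (2 * (c + v)) →
      0 < transition ω c v hω t (x, σ) {atom} := by
  have hneg : ∀ (t : ℝ) (x : ℝ≥0), (x : ℝ) < t * (2 * (c + v)) →
      0 < transition ω c v hω t (x, .neg2) {atom} := by
    intro t x hx
    have hx0 : (0 : ℝ) ≤ x := x.2
    have ht : 0 < t := by
      by_contra h
      nlinarith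
    have hfirst := lintegral_transition_eq_first_jump (c := c) (v := v) hω ht.le
      (f := ({atom} : Set State).indicator 1)
      (measurable_one.indicator (measurableSet_singleton _)) (x, .neg2)
    simp only [lintegral_indicator_one (measurableSet_singleton _)] at hfirst
    have hΦ : clampedFlow c v t (x, .neg2) = atom := by
      refine Prod.ext ?_ rfl
      refine Real.toNNReal_of_nonpos ?_
      simp only [flow, RelVel.val]
      linarith
    rw [hfirst, hΦ, Set.indicator_of_mem (Set.mem_singleton _), Pi.one_apply, mul_one]
    refine lt_of_lt_of_le ?_ le_self_add
    simpa [survival] using Real.exp_pos _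
  -- From velocity -2 the flow without jumps suffices. Velocity 0 can jump to -2, and velocity 2 can
  -- jump to 0.
  have hzero := transition_atom_pos_of_jump (σ := .zero) hω hc hcv (fun F hF => by
    rw [lintegral_jumpLaw hω]
    exact lt_of_lt_of_le (ENNReal.mul_pos (by simp) hF.ne') le_add_self) hneg
  cases σ
  · exact transition_atom_pos_of_jump hω hc hcv (fun F hF => by rwa [lintegral_jumpLaw hω]) hzero
  · exact hzero
  · exact hneg

/-- Some set of positions below `n` has positive mass, and after time `n / (2 * (c + v))` each of
its states has positive probability of being at `atom`. -/
lemma atom_pos_of_invariant (hω : 0 < ω) (hc : 0 < c) (hcv : c < v) {μ : Measure State}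
    (h0 : μ ≠ 0) (hinv : ∀ t : ℝ, 0 ≤ t → (transition ω c v hω t).Invariant μ) :
    0 < μ {atom} := by
  have hU : (⋃ n : ℕ, {z : State | (z.1 : ℝ) < n}) = Set.univ := by
    refine Set.eq_univ_of_forall fun z => Set.mem_iUnion.2 ?_
    exact exists_nat_gt (z.1 : ℝ)
  obtain ⟨n, hn⟩ := exists_measure_pos_of_not_measure_iUnion_null (μ := μ)
    (s := fun n : ℕ => {z : State | (z.1 : ℝ) < n}) (by rwa [hU, ne_eq, Measure.measure_univ_eq_zero])
  have hcv0 : 0 < 2 * (c + v) := by linarith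
  rw [← invariant_apply (hinv (n / (2 * (c + v))) (by positivity)) (measurableSet_singleton _),
    lintegral_pos_iff_support (Kernel.measurable_coe _ (measurableSet_singleton _))]
  refine hn.trans_le (measure_mono fun z hz => ?_)
  refine (transition_atom_pos hω hc hcv z.2 _ z.1 ?_).ne'
  rw [div_mul_cancel₀ _ hcv0.ne']
  exact hz

/-- The image of `μ ⊓ ν` lies below both `μ` and `ν`, hence below `μ ⊓ ν`. A Markov kernel preserves
the total mass, which is finite, so equality holds. -/
lemma invariant_of_le {κ : Kernel State State} [IsMarkovKernel κ] {μ ν : Measure State}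
    [IsFiniteMeasure μ] (hμ : κ.Invariant μ) (hν : κ.Invariant ν) : κ.Invariant (μ ⊓ ν) := by
  have hfin : IsFiniteMeasure (μ ⊓ ν) := isFiniteMeasure_of_le μ inf_le_left
  have hle : ∀ {ρ : Measure State}, κ.Invariant ρ → μ ⊓ ν ≤ ρ → (μ ⊓ ν).bind κ ≤ ρ := by
    intro ρ hρ h
    refine Measure.le_iff.2 fun s hs => ?_
    rw [Measure.bind_apply hs (Kernel.aemeasurable _), ← invariant_apply hρ hs]
    exact lintegral_mono' h le_rfl
  refine Measure.eq_of_le_of_measure_univ_eq (le_inf (hle hμ inf_le_left) (hle hν inf_le_right)) ?_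
  rw [Measure.bind_apply MeasurableSet.univ (Kernel.aemeasurable _)]
  simp

lemma invariant_sub {κ : Kernel State State} {μ ν : Measure State} [IsFiniteMeasure ν]
    (hμ : κ.Invariant μ) (hν : κ.Invariant ν) (h : ν ≤ μ) : κ.Invariant (μ - ν) := by
  refine Measure.ext fun s hs => ?_
  rw [Measure.bind_apply hs (Kernel.aemeasurable _)]
  have h1 := invariant_apply hμ hs
  rw [← Measure.sub_add_cancel_of_le h, lintegral_add_measure, invariant_apply hν hs,
    Measure.add_apply] at h1
  exact (ENNReal.add_left_inj (measure_ne_top ν s)).1 h1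

/-- The excesses of `μ` and `ν` over `μ ⊓ ν` are invariant and mutually singular in effect, while
nonzero invariant measures share the point `atom`. So one excess vanishes. -/
lemma eq_of_isInvariantProbability (hω : 0 < ω) (hc : 0 < c) (hcv : c < v) {μ ν : Measure State}
    (hμ : IsInvariantProbability ω c v hω μ) (hν : IsInvariantProbability ω c v hω ν) : μ = ν := by
  obtain ⟨hμ1, hμ⟩ := hμ
  obtain ⟨hν1, hν⟩ := hν
  have hmk := isMarkovKernel_transition (c := c) (v := v) hω
  have hfin : IsFiniteMeasure (μ ⊓ ν) := isFiniteMeasure_of_le μ inf_le_left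
  have hinf := fun t ht => invariant_of_le (hμ t ht) (hν t ht)
  have hatom : ∀ {ρ : Measure State}, (∀ t : ℝ, 0 ≤ t → (transition ω c v hω t).Invariant ρ) →
      μ ⊓ ν ≤ ρ → ρ - μ ⊓ ν ≠ 0 → 0 < (ρ - μ ⊓ ν) {atom} := fun hρ hle h0 =>
    atom_pos_of_invariant hω hc hcv h0 fun t ht => invariant_sub (hρ t ht) (hinf t ht) hle
  have heq : ∀ {ρ : Measure State}, μ ⊓ ν ≤ ρ → ρ - μ ⊓ ν = 0 → ρ = μ ⊓ ν := fun hle h0 => by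
    rw [← Measure.sub_add_cancel_of_le hle, h0, zero_add]
  by_cases hμ0 : μ - μ ⊓ ν = 0
  · have hle : μ ≤ ν := (heq inf_le_left hμ0).le.trans inf_le_right
    exact Measure.eq_of_le_of_measure_univ_eq hle (by simp)
  by_cases hν0 : ν - μ ⊓ ν = 0
  · have hle : ν ≤ μ := (heq inf_le_right hν0).le.trans inf_le_left
    exact (Measure.eq_of_le_of_measure_univ_eq hle (by simp)).symm
  exfalso
  -- A point mass that fits under both excesses: added to `μ ⊓ ν` it would give a strictly larger
  -- common lower bound.
  let r := min ((μ - μ ⊓ ν) {atom}) ((ν - μ ⊓ ν) {atom})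
  have hr : 0 < r := lt_min (hatom hμ inf_le_left hμ0) (hatom hν inf_le_right hν0)
  have hle : ∀ {ρ : Measure State}, μ ⊓ ν ≤ ρ → r ≤ (ρ - μ ⊓ ν) {atom} →
      r • Measure.dirac atom + μ ⊓ ν ≤ ρ := by
    intro ρ hρ hrρ
    conv_rhs => rw [← Measure.sub_add_cancel_of_le hρ]
    refine add_le_add_left (Measure.le_iff.2 fun s hs => ?_) _
    rw [Measure.smul_apply, Measure.dirac_apply' _ hs, smul_eq_mul]
    by_cases ha : atom ∈ s
    · simpa [ha] using hrρ.trans (measure_mono (Set.singleton_subset_iff.2 ha))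
    · simp [ha]
  have h := le_inf (hle inf_le_left (min_le_left _ _)) (hle inf_le_right (min_le_right _ _)) {atom}
  simp only [Measure.add_apply, Measure.smul_apply, smul_eq_mul,
    Measure.dirac_apply_of_mem (Set.mem_singleton _), mul_one] at h
  have hne := measure_ne_top (μ ⊓ ν) {atom}
  exact absurd h (not_le.2 (by rw [add_comm]; exact ENNReal.lt_add_right hne hr.ne'))

end RunTumble

end
theorem mainTheorem2 (ω c v : ℝ) (hω : 0 < ω) (hc : 0 < c) (hcv : c < v) :
    (RunTumble.IsInvariantProbability ω c v hω (RunTumble.explicitMeasure ω c v) ∧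
      ∀ μ : Measure RunTumble.State, RunTumble.IsInvariantProbability ω c v hω μ →
        μ = RunTumble.explicitMeasure ω c v) ∧
    RunTumble.diracWeight c v .pos2 = 0 ∧
    0 < RunTumble.diracWeight c v .zero ∧
    0 < RunTumble.diracWeight c v .neg2 := by
  have hinv := RunTumble.isInvariantProbability_explicitMeasure hω hc hcv
  have hv : 0 < v := hc.trans hcv
  refine ⟨⟨hinv, fun μ hμ => RunTumble.eq_of_isInvariantProbability hω hc hcv hμ hinv⟩,
    rfl, ?_, ?_⟩
  · simp only [RunTumble.diracWeight]
    positivity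
  · simp only [RunTumble.diracWeight]
    positivity
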